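/- Let $N$ be a free abelian group of finite rank, $N^*=\mathrm{Hom}(N,\mathbb Z)$, and let $V=\{v_i\}_{i=1}^m$ be a finite family of non-zero elements of $N$ which generates a subgroup of full rank. An element $\alpha\in N^*$ is of *type 1* if $|\langle\alpha,v_i\rangle|=1$ for exactly one $i$ and $\langle\alpha,v_k\rangle=0$ for all $k\ne i$; it is of *type 2* if $|\langle\alpha,v_i\rangle|=|\langle\alpha,v_j\rangle|=1$ for some $i\ne j$ and $\langle\alpha,v_k\rangle=0$ for all $k\neq i,j$. Let $R(V)\subset N^*$ be the set of all elements of type 1 or type 2; with the scalar product $(\alpha,\beta)=\sum_{i=1}^m\langle\alpha,v_i\rangle\langle\beta,v_i\rangle$ it is a root system in its real span. Two type 2 elements $\alpha,\beta$ of $R(V)$ are *conjugate* if they are linearly independent and pair to $\pm1$ with $v_i$ and $v_j$, and to $0$ with all other $v_k$, for a common pair of indices $i\neq j$. A *subsystem* of $R(V)$ is a subset $\Phi$ stable under the reflections $\beta\mapsto\beta-\frac{2(\beta,\alpha)}{(\alpha,\alpha)}\alpha$ for all $\alpha\in\Phi$; its rank is the dimension of its real span. Let $\Phi$ be an irreducible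 subsystem of $R(V)$ of rank $\ge 2$. Then $\Phi$ is of type $A_n$ $(n\ge1)$, $B_n$ $(n\ge2)$ or $D_n$ $(n\ge 4)$ for some $n$. More precisely, for every choice of a base (set of simple roots) of $\Phi$: 1. $\Phi$ is of type B if and only if some simple root is of type 1; 2. $\Phi$ is of type $D_n$ for some $n\ge4$ if and only if $\operatorname{rank}\Phi\ge4$, all simple roots are of type 2 and two of the simple roots are conjugate; 3. $\Phi$ is of type A if and only if all simple roots are of type 2 and, unless $\operatorname{rank}\Phi=3$, no two simple roots are conjugate. (In rank 3, where $A_3=D_3$, $\Phi$ is of type A if and only if all simple roots are of type 2.) -/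

import Mathlib

open Module

namespace LatticeRoots

variable {N : Type*} [AddCommGroup N] {ι : Type*}

/-- `α` is of type 1 with respect to `v`: it pairs to `±1` with exactly one `v i` and to `0` with
all the others. -/
def IsType1 (v : ι → N) (α : Dual ℤ N) : Prop :=
  ∃ i, |α (v i)| = 1 ∧ ∀ k, k ≠ i → α (v k) = 0

/-- `α` is of type 2 with respect to `v`: it pairs to `±1` with exactly two of the `v i` and to `0`
with all the others. -/
def IsType2 (v : ι → N) (α : Dual ℤ N) : Prop :=
  ∃ i j, i ≠ j ∧ |α (v i)| = 1 ∧ |α (v j)| = 1 ∧ ∀ k, k ≠ i → k ≠ j → α (v k) = 0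

/-- The set `R(V)` of all elements of type 1 or type 2 in the dual lattice. -/
def rootSet (v : ι → N) : Set (Dual ℤ N) :=
  {α | IsType1 v α ∨ IsType2 v α}

/-- Type 2 elements `α`, `β` are conjugate if, for a common pair `i ≠ j`, they pair to `±1` with
`v i` and `v j` and to `0` with all other `v k`, and they are linearly independent. -/
def IsConjugate (v : ι → N) (α β : Dual ℤ N) : Prop :=
  (∃ i j, i ≠ j ∧ |α (v i)| = 1 ∧ |α (v j)| = 1 ∧ |β (v i)| = 1 ∧ |β (v j)| = 1 ∧
    ∀ k, k ≠ i → k ≠ j → α (v k) = 0 ∧ β (v k) = 0) ∧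
  LinearIndependent ℤ ![α, β]

section Form

variable [Fintype ι]

/-- The scalar product `(α, β) = ∑ i, ⟨α, v i⟩ ⟨β, v i⟩` on the dual lattice. -/
def form (v : ι → N) (α β : Dual ℤ N) : ℤ :=
  ∑ i, α (v i) * β (v i)

/-- The integer `2 (β, α) / (α, α)`. The division is exact for `α ∈ R(V)`,
see `cartanInt_mul_form`. -/
def cartanInt (v : ι → N) (β α : Dual ℤ N) : ℤ :=
  2 * form v β α / form v α α

/-- The reflection `β ↦ β - (2 (β, α) / (α, α)) α` in `α ∈ R(V)`. -/
def reflect (v : ι → N) (α β : Dual ℤ N) : Dual ℤ N :=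
  β - cartanInt v β α • α

theorem form_self_of_isType1 {v : ι → N} {α : Dual ℤ N} (h : IsType1 v α) : form v α α = 1 := by
  obtain ⟨i, hi, h0⟩ := h
  rw [form, Finset.sum_eq_single i (fun k _ hk ↦ by simp [h0 k hk]) (by simp),
    ← abs_mul_abs_self, hi, one_mul]

theorem form_self_of_isType2 {v : ι → N} {α : Dual ℤ N} (h : IsType2 v α) : form v α α = 2 := by
  classical
  obtain ⟨i, j, hij, hi, hj, h0⟩ := h
  rw [form, Finset.sum_eq_add i j hij (fun k _ hk ↦ by simp [h0 k hk.1 hk.2]) (by simp) (by simp),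
    ← abs_mul_abs_self (α (v i)), ← abs_mul_abs_self (α (v j)), hi, hj]
  norm_num

theorem form_self_eq {v : ι → N} {α : Dual ℤ N} (h : α ∈ rootSet v) :
    form v α α = 1 ∨ form v α α = 2 :=
  h.imp form_self_of_isType1 form_self_of_isType2

theorem cartanInt_mul_form {v : ι → N} {α : Dual ℤ N} (h : α ∈ rootSet v) (β : Dual ℤ N) :
    cartanInt v β α * form v α α = 2 * form v β α := by
  rcases form_self_eq h with h | h <;> simp [cartanInt, h, mul_comm]

theorem form_sub_smul (v : ι → N) (α β γ : Dual ℤ N) (c : ℤ) :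
    form v (β - c • α) γ = form v β γ - c * form v α γ := by
  simp only [form, Finset.mul_sum, ← Finset.sum_sub_distrib]
  refine Finset.sum_congr rfl fun i _ ↦ ?_
  simp only [LinearMap.sub_apply, LinearMap.smul_apply, smul_eq_mul]
  ring

theorem form_comm (v : ι → N) (α β : Dual ℤ N) : form v α β = form v β α := by
  simp only [form, mul_comm]

theorem form_self_ne_zero {v : ι → N} {α : Dual ℤ N} (h : α ∈ rootSet v) : form v α α ≠ 0 := by
  rcases form_self_eq h with h | h <;> omega

theorem cartanInt_self {v : ι → N} {α : Dual ℤ N} (h : α ∈ rootSet v) : cartanInt v α α = 2 :=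
  mul_right_cancel₀ (form_self_ne_zero h) (cartanInt_mul_form h α)

theorem cartanInt_reflect {v : ι → N} {α : Dual ℤ N} (h : α ∈ rootSet v) (β : Dual ℤ N) :
    cartanInt v (reflect v α β) α = -cartanInt v β α := by
  refine mul_right_cancel₀ (form_self_ne_zero h) ?_
  rw [cartanInt_mul_form h, reflect, form_sub_smul]
  linear_combination (-1 : ℤ) * cartanInt_mul_form h β

theorem reflect_reflect {v : ι → N} {α : Dual ℤ N} (h : α ∈ rootSet v) (β : Dual ℤ N) :
    reflect v α (reflect v α β) = β := by
  conv_lhs => rw [reflect, cartanInt_reflect h, reflect]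
  simp

theorem form_reflect_self {v : ι → N} {α : Dual ℤ N} (h : α ∈ rootSet v) (β : Dual ℤ N) :
    form v (reflect v α β) (reflect v α β) = form v β β := by
  rw [reflect, form_sub_smul, form_comm v β, form_comm v α, form_sub_smul, form_sub_smul,
    form_comm v α β]
  linear_combination cartanInt v β α * cartanInt_mul_form h β

end Form

/-- The map `α ↦ (⟨α, v i⟩)_i` from the dual lattice to `ℝ^ι`. -/
def evalVec (v : ι → N) (α : Dual ℤ N) : ι → ℝ :=
  fun i ↦ (α (v i) : ℝ)

theorem evalVec_sub_smul (v : ι → N) (α β : Dual ℤ N) (c : ℤ) :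
    evalVec v (β - c • α) = evalVec v β - (c : ℝ) • evalVec v α := by
  ext i
  simp [evalVec]

theorem evalVec_injective [Module.Free ℤ N] [Module.Finite ℤ N] {v : ι → N}
    (hv : finrank ℤ (Submodule.span ℤ (Set.range v)) = finrank ℤ N) :
    Function.Injective (evalVec v) := by
  intro α β h
  let g : N →ₗ[ℤ] ℤ := α - β
  have hsub : Submodule.span ℤ (Set.range v) ≤ LinearMap.ker g := by
    rw [Submodule.span_le]
    rintro _ ⟨i, rfl⟩
    have := congrFun h i
    simp only [evalVec, Int.cast_inj] at this
    simp [g, this]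
  have hle := Submodule.finrank_mono hsub
  have hsum := (LinearMap.ker g).finrank_quotient_add_finrank
  rw [g.quotKerEquivRange.finrank_eq] at hsum
  have h0 : finrank ℤ (LinearMap.range g) = 0 := by omega
  have hr := Submodule.finrank_eq_zero.mp h0
  exact sub_eq_zero.mp (LinearMap.range_eq_bot.mp hr)

section Dot

variable [Fintype ι]

theorem evalVec_dotProduct (v : ι → N) (α β : Dual ℤ N) :
    evalVec v α ⬝ᵥ evalVec v β = (form v α β : ℝ) := by
  simp [evalVec, dotProduct, form]

/-- A root subsystem of `R(V)`: a subset which is stable under the reflections in its elements. -/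
structure Subsystem (v : ι → N) where
  carrier : Set (Dual ℤ N)
  subset_rootSet : carrier ⊆ rootSet v
  reflect_mem : ∀ α ∈ carrier, ∀ β ∈ carrier, reflect v α β ∈ carrier

namespace Subsystem

variable {v : ι → N} (Φ : Subsystem v)

/-- The real vector space spanned by a subsystem, where the dual lattice is viewed inside `ℝ^ι`
through `evalVec`. -/
def rootSpace : Submodule ℝ (ι → ℝ) :=
  Submodule.span ℝ (evalVec v '' Φ.carrier)

/-- The rank of a subsystem: the dimension of its span. -/
noncomputable def rank : ℕ :=
  finrank ℝ Φ.rootSpace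

/-- An element of a subsystem as a vector in the root space. -/
def rootVec (α : Φ.carrier) : Φ.rootSpace :=
  ⟨evalVec v α.1, Submodule.subset_span ⟨α.1, α.2, rfl⟩⟩

/-- The coroot `x ↦ 2 (x, α) / (α, α)` of `α`. -/
noncomputable def corootVec (α : Φ.carrier) : Dual ℝ Φ.rootSpace where
  toFun x := 2 / (form v α.1 α.1 : ℝ) * (x.1 ⬝ᵥ evalVec v α.1)
  map_add' x y := by simp [add_dotProduct, mul_add]
  map_smul' c x := by simp [smul_dotProduct, mul_left_comm]

theorem corootVec_rootVec (α β : Φ.carrier) :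
    Φ.corootVec α (Φ.rootVec β) = (cartanInt v β.1 α.1 : ℝ) := by
  have h0 : (form v α.1 α.1 : ℝ) ≠ 0 :=
    Int.cast_ne_zero.mpr (form_self_ne_zero (Φ.subset_rootSet α.2))
  have h1 : (cartanInt v β.1 α.1 : ℝ) * form v α.1 α.1 = 2 * form v β.1 α.1 := by
    exact_mod_cast cartanInt_mul_form (Φ.subset_rootSet α.2) β.1
  change 2 / (form v α.1 α.1 : ℝ) * (evalVec v β.1 ⬝ᵥ evalVec v α.1) = _
  rw [evalVec_dotProduct]
  field_simp
  linarith

/-- The permutation of a subsystem induced by the reflection in one of its elements. -/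
def reflectPerm (α : Φ.carrier) : Φ.carrier ≃ Φ.carrier where
  toFun β := ⟨reflect v α.1 β.1, Φ.reflect_mem _ α.2 _ β.2⟩
  invFun β := ⟨reflect v α.1 β.1, Φ.reflect_mem _ α.2 _ β.2⟩
  left_inv β := Subtype.ext (reflect_reflect (Φ.subset_rootSet α.2) β.1)
  right_inv β := Subtype.ext (reflect_reflect (Φ.subset_rootSet α.2) β.1)

variable [Module.Free ℤ N] [Module.Finite ℤ N]

theorem corootVec_injective (hv : finrank ℤ (Submodule.span ℤ (Set.range v)) = finrank ℤ N) :
    Function.Injective Φ.corootVec := by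
  intro α β h
  have ha : (form v α.1 α.1 : ℝ) ≠ 0 :=
    Int.cast_ne_zero.mpr (form_self_ne_zero (Φ.subset_rootSet α.2))
  have hb : (form v β.1 β.1 : ℝ) ≠ 0 :=
    Int.cast_ne_zero.mpr (form_self_ne_zero (Φ.subset_rootSet β.2))
  have key : ∀ x : Φ.rootSpace, x.1 ⬝ᵥ ((2 / (form v α.1 α.1 : ℝ)) • evalVec v α.1 -
      (2 / (form v β.1 β.1 : ℝ)) • evalVec v β.1) = 0 := by
    intro x
    have hx : 2 / (form v α.1 α.1 : ℝ) * (x.1 ⬝ᵥ evalVec v α.1) =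
        2 / (form v β.1 β.1 : ℝ) * (x.1 ⬝ᵥ evalVec v β.1) := LinearMap.congr_fun h x
    simpa [dotProduct_sub, dotProduct_smul, sub_eq_zero] using hx
  have h0 := key ((2 / (form v α.1 α.1 : ℝ)) • Φ.rootVec α -
    (2 / (form v β.1 β.1 : ℝ)) • Φ.rootVec β)
  have h1 : (2 / (form v α.1 α.1 : ℝ)) • evalVec v α.1 =
      (2 / (form v β.1 β.1 : ℝ)) • evalVec v β.1 :=
    sub_eq_zero.mp (dotProduct_self_eq_zero.mp h0)
  have h2 : 2 / (form v α.1 α.1 : ℝ) = 2 / (form v β.1 β.1 : ℝ) := by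
    have h3 := congrArg (fun w ↦ w ⬝ᵥ w) h1
    simp only [smul_dotProduct, dotProduct_smul, evalVec_dotProduct, smul_eq_mul] at h3
    field_simp at h3 ⊢
    linarith
  rw [← h2] at h1
  exact Subtype.ext (evalVec_injective hv
    (smul_right_injective _ (div_ne_zero two_ne_zero ha) h1))

/-- A subsystem `Φ` as a root pairing in the sense of Mathlib: the roots are the elements of `Φ`,
viewed in their real span, and the coroots are the functionals `x ↦ 2 (x, α) / (α, α)`. -/
noncomputable def rootPairing
    (hv : finrank ℤ (Submodule.span ℤ (Set.range v)) = finrank ℤ N) :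
    RootPairing Φ.carrier ℝ Φ.rootSpace (Dual ℝ Φ.rootSpace) where
  toLinearMap := Dual.eval ℝ Φ.rootSpace
  root := ⟨Φ.rootVec, fun _ _ h ↦ Subtype.ext (evalVec_injective hv (congrArg Subtype.val h))⟩
  coroot := ⟨Φ.corootVec, Φ.corootVec_injective hv⟩
  root_coroot_two α := by
    change Φ.corootVec α (Φ.rootVec α) = 2
    simp [corootVec_rootVec, cartanInt_self (Φ.subset_rootSet α.2)]
  reflectionPerm := Φ.reflectPerm
  reflectionPerm_root α β := by
    change Φ.rootVec β - Φ.corootVec α (Φ.rootVec β) • Φ.rootVec α =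
      Φ.rootVec (Φ.reflectPerm α β)
    rw [corootVec_rootVec]
    exact Subtype.ext (evalVec_sub_smul v α.1 β.1 _).symm
  reflectionPerm_coroot α β := by
    change Φ.corootVec β - Φ.corootVec β (Φ.rootVec α) • Φ.corootVec α =
      Φ.corootVec (Φ.reflectPerm α β)
    rw [corootVec_rootVec]
    ext x
    have ha : (form v α.1 α.1 : ℝ) ≠ 0 :=
      Int.cast_ne_zero.mpr (form_self_ne_zero (Φ.subset_rootSet α.2))
    have hb : (form v β.1 β.1 : ℝ) ≠ 0 :=
      Int.cast_ne_zero.mpr (form_self_ne_zero (Φ.subset_rootSet β.2))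
    have h1 : (cartanInt v β.1 α.1 : ℝ) * form v α.1 α.1 = 2 * form v β.1 α.1 := by
      exact_mod_cast cartanInt_mul_form (Φ.subset_rootSet α.2) β.1
    have h2 : (cartanInt v α.1 β.1 : ℝ) * form v β.1 β.1 = 2 * form v β.1 α.1 := by
      rw [form_comm v β.1 α.1]
      exact_mod_cast cartanInt_mul_form (Φ.subset_rootSet β.2) α.1
    change 2 / (form v β.1 β.1 : ℝ) * (x.1 ⬝ᵥ evalVec v β.1) -
      (cartanInt v α.1 β.1 : ℝ) * (2 / (form v α.1 α.1 : ℝ) * (x.1 ⬝ᵥ evalVec v α.1)) =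
      2 / (form v (reflect v α.1 β.1) (reflect v α.1 β.1) : ℝ) *
        (x.1 ⬝ᵥ evalVec v (reflect v α.1 β.1))
    rw [form_reflect_self (Φ.subset_rootSet α.2), reflect, evalVec_sub_smul, dotProduct_sub,
      dotProduct_smul, smul_eq_mul]
    field_simp
    linear_combination (x.1 ⬝ᵥ evalVec v α.1) * (h1 - h2)

instance (hv : finrank ℤ (Submodule.span ℤ (Set.range v)) = finrank ℤ N) :
    (Φ.rootPairing hv).IsCrystallographic where
  exists_value α β := ⟨cartanInt v α.1 β.1, (Φ.corootVec_rootVec β α).symm⟩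

end Subsystem

end Dot

/-- A crystallographic root pairing has Cartan matrix `C` if, for some base and some numbering of
its simple roots, the Cartan matrix of that base is `C`. -/
def HasCartanMatrix {κ R M M' : Type*} [CommRing R] [AddCommGroup M] [Module R M]
    [AddCommGroup M'] [Module R M'] (P : RootPairing κ R M M') [P.IsCrystallographic]
    {n : ℕ} (C : Matrix (Fin n) (Fin n) ℤ) : Prop :=
  ∃ (b : P.Base) (e : b.support ≃ Fin n), b.cartanMatrix.reindex e e = C

/-- The root pairing is of type `A n` for some `n ≥ 1`. -/
def IsOfTypeA {κ R M M' : Type*} [CommRing R] [AddCommGroup M] [Module R M]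
    [AddCommGroup M'] [Module R M'] (P : RootPairing κ R M M') [P.IsCrystallographic] : Prop :=
  ∃ n, 1 ≤ n ∧ HasCartanMatrix P (CartanMatrix.A n)

/-- The root pairing is of type `B n` for some `n ≥ 2`. In `CartanMatrix.B n` the last simple root
is the short one. -/
def IsOfTypeB {κ R M M' : Type*} [CommRing R] [AddCommGroup M] [Module R M]
    [AddCommGroup M'] [Module R M'] (P : RootPairing κ R M M') [P.IsCrystallographic] : Prop :=
  ∃ n, 2 ≤ n ∧ HasCartanMatrix P (CartanMatrix.B n)

/-- The root pairing is of type `D n` for some `n ≥ 4`. -/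
def IsOfTypeD {κ R M M' : Type*} [CommRing R] [AddCommGroup M] [Module R M]
    [AddCommGroup M'] [Module R M'] (P : RootPairing κ R M M') [P.IsCrystallographic] : Prop :=
  ∃ n, 4 ≤ n ∧ HasCartanMatrix P (CartanMatrix.D n)

end LatticeRoots

open LatticeRoots

/-! The map sending α to (⟨α, v_i⟩)_i embeds R(V) in ℝ^ι as vectors with one ("short") or two
("long") non-zero coordinates, all ±1. The simple roots become a linearly independent family with
non-positive scalar products (`IsSimpleSystem`), and irreducibility makes their non-orthogonality
graph connected.

Two members sharing a coordinate either have the same support and are orthogonal, or have product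
-1. If no supports coincide, a vertex has at most one neighbour per non-zero coordinate, hence at
most two; positive definiteness supplies a leaf, and the graph is a path.

A short vector, or a pair with the same support, spans the coordinate vectors of its support. Such a
core grows along edges, so linear independence and connectedness forbid two disjoint cores
(`not_disjoint_cores`). Hence there is at most one short vector or one conjugate pair, never both. A
short vector ends the path (type B); a conjugate pair forms the fork of D_n; if neither occurs the
type is A.

The type is witnessed by some base, while the criteria concern every base. Two facts transfer them.
The coordinate sum is even on long vectors and odd on short ones, so long simple roots force all
roots to be long. If moreover no two simple roots are conjugate, some vector without zero
coordinates is orthogonal to all simple roots, hence to all roots, and this excludes conjugate roots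
altogether (`exists_orthogonal`). Finally B has an entry -2, and D_n with n ≥ 4 a vertex of degree
three, which separates the types. -/

namespace LatticeRoots

/-! ### Recognising paths among connected graphs -/

section Graph

variable {V : Type*} {G : SimpleGraph V}

theorem exists_adj_dist_eq_of_dist_eq_succ (hc : G.Connected) {u w : V} {d : ℕ}
    (h : G.dist u w = d + 1) : ∃ p, G.Adj p w ∧ G.dist u p = d := by
  obtain ⟨q, hq⟩ := hc.exists_walk_length_eq_dist w u
  rw [SimpleGraph.dist_comm, h] at hq
  cases q with
  | nil => simp at hq
  | @cons _ p _ hwp q =>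
    refine ⟨p, hwp.symm, ?_⟩
    have h1 : G.dist p u ≤ q.length := SimpleGraph.dist_le q
    have h2 : G.dist u w ≤ G.dist u p + G.dist p w := hc.dist_triangle
    rw [SimpleGraph.dist_eq_one_iff_adj.mpr hwp.symm] at h2
    rw [SimpleGraph.dist_comm] at h1
    simp only [SimpleGraph.Walk.length_cons] at hq
    omega

theorem exists_adj_of_ne (hc : G.Connected) {p q : V} (hpq : p ≠ q) : ∃ c, G.Adj p c := by
  obtain ⟨w⟩ := hc.preconnected p q
  cases w with
  | nil => exact absurd rfl hpq
  | cons h _ => exact ⟨_, h⟩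

/-- Every vertex of the graph has at most two neighbours. -/
def HasDegreeLeTwo (G : SimpleGraph V) : Prop :=
  ∀ k l m p, G.Adj k l → G.Adj k m → G.Adj k p → l = m ∨ l = p ∨ m = p

/-- Induction on the distance: two vertices at distance d + 1 have predecessors at distance d, which
coincide. That predecessor already has a neighbour nearer to `u`, or is the leaf `u`, so only one
neighbour is left for both. -/
theorem dist_injective_of_leaf (hc : G.Connected) (h3 : HasDegreeLeTwo G) {u : V}
    (hu : ∀ l m, G.Adj u l → G.Adj u m → l = m) : Function.Injective (G.dist u) := by
  have key : ∀ d v w, G.dist u v = d → G.dist u w = d → v = w := by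
    intro d
    induction d with
    | zero =>
      intro v w hv hw
      rw [hc.dist_eq_zero_iff] at hv hw
      exact hv.symm.trans hw
    | succ d ih =>
      intro v w hv hw
      obtain ⟨p, hpv, hp⟩ := exists_adj_dist_eq_of_dist_eq_succ hc hv
      obtain ⟨q, hqw, hq⟩ := exists_adj_dist_eq_of_dist_eq_succ hc hw
      obtain rfl := ih p q hp hq
      cases d with
      | zero =>
        rw [hc.dist_eq_zero_iff] at hp
        subst hp
        exact hu v w hpv hqw
      | succ d =>
        obtain ⟨r, hrp, hr⟩ := exists_adj_dist_eq_of_dist_eq_succ hc hp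
        rcases h3 p v w r hpv hqw hrp.symm with h | h | h
        · exact h
        · subst h; omega
        · subst h; omega
  exact fun v w h ↦ key _ v w rfl h.symm

/-- A finite connected graph with all degrees at most two and with a vertex `u` of degree at most
one is a path ending in `u`. -/
theorem exists_path_numbering [Fintype V] (hc : G.Connected) (h3 : HasDegreeLeTwo G) {u : V}
    (hu : ∀ l m, G.Adj u l → G.Adj u m → l = m) :
    ∃ e : V ≃ Fin (Fintype.card V), (e u).val + 1 = Fintype.card V ∧
      ∀ v w, G.Adj v w ↔ (e v).val + 1 = (e w).val ∨ (e w).val + 1 = (e v).val := by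
  classical
  have hinj := dist_injective_of_leaf hc h3 hu
  -- The distances attained form an initial segment of ℕ and are distinct, hence stay below the
  -- number of vertices.
  have hdown : ∀ d w, G.dist u w = d → ∀ k ≤ d, ∃ z, G.dist u z = k := by
    intro d
    induction d with
    | zero => exact fun w hw k hk ↦ ⟨w, by omega⟩
    | succ d ih =>
      intro w hw k hk
      rcases hk.eq_or_lt with rfl | hk
      · exact ⟨w, hw⟩
      · obtain ⟨p, -, hp⟩ := exists_adj_dist_eq_of_dist_eq_succ hc hw
        exact ih p hp k (by omega)
  have hlt : ∀ w, G.dist u w < Fintype.card V := by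
    intro w
    choose z hz using fun k : Fin (G.dist u w + 1) ↦ hdown _ w rfl k.1 (by omega)
    have hzinj : Function.Injective z := by
      intro i j hij
      ext
      rw [← hz i, ← hz j, hij]
    have := Fintype.card_le_of_injective z hzinj
    rw [Fintype.card_fin] at this
    omega
  let f : V → Fin (Fintype.card V) := fun w ↦ ⟨G.dist u w, hlt w⟩
  have hf : Function.Bijective f :=
    (Fintype.bijective_iff_injective_and_card f).mpr
      ⟨fun v w h ↦ hinj (congrArg Fin.val h), by simp⟩
  -- The order is reversed because the matrices B and D have their special vertices at the end.
  let e := (Equiv.ofBijective f hf).trans Fin.revPerm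
  have he : ∀ w, (e w).val = Fintype.card V - (G.dist u w + 1) := fun w ↦ rfl
  have hsucc : ∀ v w, G.dist u v + 1 = G.dist u w → G.Adj v w := by
    intro v w h
    obtain ⟨p, hpw, hp⟩ := exists_adj_dist_eq_of_dist_eq_succ hc h.symm
    rwa [← hinj hp]
  refine ⟨e, ?_, fun v w ↦ ?_⟩
  · rw [he, SimpleGraph.dist_self]
    have := hlt u
    omega
  · have hv := hlt v
    have hw := hlt w
    rw [he, he]
    constructor
    · intro h
      have hne : G.dist u v ≠ G.dist u w := fun h' ↦ h.ne (hinj h')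
      have := h.diff_dist_adj (u := u)
      omega
    · rintro (h | h)
      · exact (hsucc w v (by omega)).symm
      · exact hsucc v w (by omega)

end Graph

/-! ### Short and long vectors in ℝ^ι -/

section Vectors

variable {ι : Type*}

/-- A vector with exactly one non-zero coordinate, equal to `±1`. -/
def IsShort (x : ι → ℝ) : Prop :=
  ∃ i, |x i| = 1 ∧ ∀ k, k ≠ i → x k = 0

/-- A vector with exactly two non-zero coordinates, both equal to `±1`. -/
def IsLong (x : ι → ℝ) : Prop :=
  ∃ i j, i ≠ j ∧ |x i| = 1 ∧ |x j| = 1 ∧ ∀ k, k ≠ i → k ≠ j → x k = 0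

/-- Two vectors with the same two non-zero coordinates, all equal to `±1`. -/
def SameSupport (x y : ι → ℝ) : Prop :=
  ∃ i j, i ≠ j ∧ |x i| = 1 ∧ |x j| = 1 ∧ |y i| = 1 ∧ |y j| = 1 ∧
    ∀ k, k ≠ i → k ≠ j → x k = 0 ∧ y k = 0

theorem SameSupport.symm {x y : ι → ℝ} (h : SameSupport x y) : SameSupport y x := by
  obtain ⟨i, j, hij, h1, h2, h3, h4, h0⟩ := h
  exact ⟨i, j, hij, h3, h4, h1, h2, fun k hi hj ↦ (h0 k hi hj).symm⟩

theorem SameSupport.isLong_left {x y : ι → ℝ} (h : SameSupport x y) : IsLong x := by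
  obtain ⟨i, j, hij, h1, h2, -, -, h0⟩ := h
  exact ⟨i, j, hij, h1, h2, fun k hi hj ↦ (h0 k hi hj).1⟩

theorem eq_one_or_of_abs {a : ℝ} (h : |a| = 1) : a = 1 ∨ a = -1 := by
  rwa [abs_eq zero_le_one] at h

theorem ne_zero_of_abs {a : ℝ} (h : |a| = 1) : a ≠ 0 := by
  rintro rfl
  simp at h

theorem SameSupport.ne_zero_iff {x y : ι → ℝ} (h : SameSupport x y) (t : ι) :
    x t ≠ 0 ↔ y t ≠ 0 := by
  obtain ⟨i, j, hij, h1, h2, h3, h4, h0⟩ := h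
  by_cases hi : t = i
  · subst hi
    exact iff_of_true (ne_zero_of_abs h1) (ne_zero_of_abs h3)
  by_cases hj : t = j
  · subst hj
    exact iff_of_true (ne_zero_of_abs h2) (ne_zero_of_abs h4)
  simp [h0 t hi hj]

theorem abs_eq_one_of_ne_zero {x : ι → ℝ} (hx : IsShort x ∨ IsLong x) {t : ι} (ht : x t ≠ 0) :
    |x t| = 1 := by
  rcases hx with ⟨i, hi, h0⟩ | ⟨i, j, -, hi, hj, h0⟩
  · by_cases h : t = i
    · rwa [h]
    · exact absurd (h0 t h) ht
  · by_cases h : t = i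
    · rwa [h]
    · by_cases h' : t = j
      · rwa [h']
      · exact absurd (h0 t h h') ht

theorem exists_support_subset_pair {x : ι → ℝ} (hx : IsShort x ∨ IsLong x) :
    ∃ i j, ∀ t, x t ≠ 0 → t = i ∨ t = j := by
  rcases hx with ⟨i, -, h0⟩ | ⟨i, j, -, -, -, h0⟩
  · refine ⟨i, i, fun t ht ↦ Or.inl ?_⟩
    contrapose! ht
    exact h0 t ht
  · refine ⟨i, j, fun t ht ↦ ?_⟩
    contrapose! ht
    exact h0 t ht.1 ht.2

theorem eq_zero_of_two_ne_zero {x : ι → ℝ} (hx : IsShort x ∨ IsLong x) {i j : ι} (hij : i ≠ j)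
    (hi : x i ≠ 0) (hj : x j ≠ 0) {t : ι} (hti : t ≠ i) (htj : t ≠ j) : x t = 0 := by
  by_contra ht
  obtain ⟨a, b, hab⟩ := exists_support_subset_pair hx
  have h1 := hab i hi
  have h2 := hab j hj
  have h3 := hab t ht
  grind

theorem sameSupport_of_two_ne_zero {x y : ι → ℝ} (hx : IsShort x ∨ IsLong x)
    (hy : IsShort y ∨ IsLong y) {i j : ι} (hij : i ≠ j) (hi : x i ≠ 0) (hj : x j ≠ 0)
    (hi' : y i ≠ 0) (hj' : y j ≠ 0) : SameSupport x y :=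
  ⟨i, j, hij, abs_eq_one_of_ne_zero hx hi, abs_eq_one_of_ne_zero hx hj,
    abs_eq_one_of_ne_zero hy hi', abs_eq_one_of_ne_zero hy hj', fun _ h1 h2 ↦
      ⟨eq_zero_of_two_ne_zero hx hij hi hj h1 h2, eq_zero_of_two_ne_zero hy hij hi' hj' h1 h2⟩⟩

/-- `hd` is the vanishing of a 2 × 2 determinant; proportional pairs of signs agree up to a common
sign. -/
theorem SameSupport.eq_or_eq_neg {x y : ι → ℝ} {i j : ι} (h : SameSupport x y) (hij : i ≠ j)
    (hi : x i ≠ 0) (hj : x j ≠ 0) (hd : x i * y j = x j * y i) : x = y ∨ x = -y := by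
  have hx : IsShort x ∨ IsLong x := Or.inr h.isLong_left
  have hy : IsShort y ∨ IsLong y := Or.inr h.symm.isLong_left
  have hi' := (h.ne_zero_iff i).mp hi
  have hj' := (h.ne_zero_iff j).mp hj
  have h0 : ∀ t, t ≠ i → t ≠ j → x t = 0 ∧ y t = 0 := fun t h1 h2 ↦
    ⟨eq_zero_of_two_ne_zero hx hij hi hj h1 h2, eq_zero_of_two_ne_zero hy hij hi' hj' h1 h2⟩
  have ext : ∀ c : ℝ, x i = c * y i → x j = c * y j → x = c • y := by
    intro c h1 h2
    funext t
    by_cases hti : t = i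
    · simpa [hti] using h1
    by_cases htj : t = j
    · simpa [htj] using h2
    simp [h0 t hti htj]
  have e1 := eq_one_or_of_abs (abs_eq_one_of_ne_zero hx hi)
  have e2 := eq_one_or_of_abs (abs_eq_one_of_ne_zero hx hj)
  have e3 := eq_one_or_of_abs (abs_eq_one_of_ne_zero hy hi')
  have e4 := eq_one_or_of_abs (abs_eq_one_of_ne_zero hy hj')
  have key : (x i = y i ∧ x j = y j) ∨ (x i = -y i ∧ x j = -y j) := by
    rcases e1 with e1 | e1 <;> rcases e2 with e2 | e2 <;> rcases e3 with e3 | e3 <;>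
      rcases e4 with e4 | e4 <;> rw [e1, e2, e3, e4] at hd ⊢ <;> revert hd <;> norm_num
  rcases key with ⟨h1, h2⟩ | ⟨h1, h2⟩
  · left
    simpa using ext 1 (by simpa using h1) (by simpa using h2)
  · right
    simpa using ext (-1) (by simpa using h1) (by simpa using h2)

theorem single_mem_of_other [DecidableEq ι] {W : Submodule ℝ (ι → ℝ)} {y : ι → ℝ} (hy : IsShort y ∨ IsLong y)
    (hyW : y ∈ W) {a : ι} (ha : y a ≠ 0) (haW : Pi.single a (1 : ℝ) ∈ W) {t : ι} (ht : y t ≠ 0) :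
    Pi.single t (1 : ℝ) ∈ W := by
  by_cases hta : t = a
  · rwa [hta]
  have h : Pi.single t (1 : ℝ) = (y t)⁻¹ • (y - y a • Pi.single a (1 : ℝ)) := by
    funext s
    by_cases hst : s = t
    · subst hst
      simp [hta, ht]
    by_cases hsa : s = a
    · subst hsa
      simp [hst]
    · simp [hst, hsa, eq_zero_of_two_ne_zero hy hta ht ha hst hsa]
  rw [h]
  exact W.smul_mem _ (W.sub_mem hyW (W.smul_mem _ haW))

variable [Fintype ι]

theorem dotProduct_eq_of_support_pair {x y : ι → ℝ} {i j : ι} (hij : i ≠ j)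
    (h0 : ∀ k, k ≠ i → k ≠ j → x k = 0) : x ⬝ᵥ y = x i * y i + x j * y j := by
  classical
  exact Finset.sum_eq_add i j hij (fun k _ hk ↦ by simp [h0 k hk.1 hk.2]) (by simp) (by simp)

theorem dotProduct_eq_of_support_single {x y : ι → ℝ} {i : ι}
    (h0 : ∀ k, k ≠ i → x k = 0) : x ⬝ᵥ y = x i * y i :=
  Finset.sum_eq_single i (fun k _ hk ↦ by simp [h0 k hk]) (by simp)

theorem IsShort.dotProduct_self {x : ι → ℝ} (h : IsShort x) : x ⬝ᵥ x = 1 := by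
  obtain ⟨i, hi, h0⟩ := h
  rw [dotProduct_eq_of_support_single h0, ← abs_mul_abs_self, hi, one_mul]

theorem IsLong.dotProduct_self {x : ι → ℝ} (h : IsLong x) : x ⬝ᵥ x = 2 := by
  obtain ⟨i, j, hij, hi, hj, h0⟩ := h
  rw [dotProduct_eq_of_support_pair hij h0, ← abs_mul_abs_self (x i), ← abs_mul_abs_self (x j), hi,
    hj]
  norm_num

theorem SameSupport.dotProduct_eq_zero {x y : ι → ℝ} (h : SameSupport x y) (h1 : x ≠ y)
    (h2 : x ≠ -y) : x ⬝ᵥ y = 0 := by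
  obtain ⟨i, j, hij, hi, hj, hi', hj', h0⟩ := id h
  rw [dotProduct_eq_of_support_pair hij fun k a b ↦ (h0 k a b).1]
  have hd : x i * y j ≠ x j * y i := fun hd ↦
    (h.eq_or_eq_neg hij (ne_zero_of_abs hi) (ne_zero_of_abs hj) hd).elim h1 h2
  rcases eq_one_or_of_abs hi with e1 | e1 <;> rcases eq_one_or_of_abs hj with e2 | e2 <;>
    rcases eq_one_or_of_abs hi' with e3 | e3 <;> rcases eq_one_or_of_abs hj' with e4 | e4 <;>
    rw [e1, e2, e3, e4] at hd ⊢ <;> revert hd <;> norm_num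

/-- A second common coordinate would make the supports equal, so only the term at `t` survives. -/
theorem abs_dotProduct_eq_one {x y : ι → ℝ} (hx : IsShort x ∨ IsLong x)
    (hy : IsShort y ∨ IsLong y) {t : ι} (hxt : x t ≠ 0) (hyt : y t ≠ 0)
    (hs : ¬ SameSupport x y) : |x ⬝ᵥ y| = 1 := by
  have hprod : |x t * y t| = 1 := by
    rw [abs_mul, abs_eq_one_of_ne_zero hx hxt, abs_eq_one_of_ne_zero hy hyt, one_mul]
  suffices h : x ⬝ᵥ y = x t * y t by rw [h, hprod]
  refine Finset.sum_eq_single t (fun k _ hk ↦ ?_) (by simp)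
  by_contra h
  have h1 := left_ne_zero_of_mul h
  have h2 := right_ne_zero_of_mul h
  exact hs (sameSupport_of_two_ne_zero hx hy hk h1 hxt h2 hyt)

end Vectors

/-! ### Simple systems and their graphs -/

section System

variable {K ι : Type*} [Fintype ι]

/-- A linearly independent family of short and long vectors with pairwise non-positive scalar
products. -/
structure IsSimpleSystem (x : K → ι → ℝ) : Prop where
  short_or_long : ∀ k, IsShort (x k) ∨ IsLong (x k)
  linearIndependent : LinearIndependent ℝ x
  dotProduct_nonpos : ∀ k l, k ≠ l → x k ⬝ᵥ x l ≤ 0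

/-- The graph joining two distinct members of a family of vectors if they are not orthogonal. -/
def dotGraph (x : K → ι → ℝ) : SimpleGraph K where
  Adj k l := k ≠ l ∧ x k ⬝ᵥ x l ≠ 0
  symm := ⟨fun _ _ h ↦ ⟨h.1.symm, by rw [dotProduct_comm]; exact h.2⟩⟩
  loopless := ⟨fun _ h ↦ h.1 rfl⟩

theorem dotGraph_adj {x : K → ι → ℝ} {k l : K} :
    (dotGraph x).Adj k l ↔ k ≠ l ∧ x k ⬝ᵥ x l ≠ 0 :=
  Iff.rfl

namespace IsSimpleSystem

variable {x : K → ι → ℝ} (hx : IsSimpleSystem x)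
include hx

theorem comp_injective {L : Type*} {f : L → K} (hf : Function.Injective f) :
    IsSimpleSystem (x ∘ f) where
  short_or_long l := hx.short_or_long (f l)
  linearIndependent := hx.linearIndependent.comp f hf
  dotProduct_nonpos _ _ h := hx.dotProduct_nonpos _ _ (hf.ne h)

theorem self_le_two (k : K) : x k ⬝ᵥ x k ≤ 2 := by
  rcases hx.short_or_long k with h | h
  · rw [h.dotProduct_self]; norm_num
  · rw [h.dotProduct_self]

theorem ne_of_ne {k l : K} (h : k ≠ l) : x k ≠ x l :=
  hx.linearIndependent.injective.ne h

theorem ne_neg_of_ne {k l : K} (h : k ≠ l) : x k ≠ -x l := by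
  classical
  intro heq
  have := linearIndependent_iff'.mp hx.linearIndependent {k, l} (fun _ ↦ 1)
    (by simp [Finset.sum_pair h, heq]) k (by simp)
  exact one_ne_zero this

/-- The double sum is the squared length of ∑ x_k, which is non-zero by linear independence.
Subgraphs are excluded by making this sum non-positive. -/
theorem sum_dotProduct_pos {s : Finset K} (hs : s.Nonempty) :
    0 < ∑ k ∈ s, ∑ l ∈ s, x k ⬝ᵥ x l := by
  have h0 : ∑ k ∈ s, x k ≠ 0 := by
    intro h
    obtain ⟨k, hk⟩ := hs
    have := linearIndependent_iff'.mp hx.linearIndependent s (fun _ ↦ 1) (by simpa using h) k hk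
    exact one_ne_zero this
  have h1 : (∑ k ∈ s, x k) ⬝ᵥ (∑ k ∈ s, x k) = ∑ k ∈ s, ∑ l ∈ s, x k ⬝ᵥ x l := by
    rw [sum_dotProduct]
    exact Finset.sum_congr rfl fun k _ ↦ dotProduct_sum ..
  rw [← h1]
  refine lt_of_le_of_ne (Finset.sum_nonneg fun i _ ↦ mul_self_nonneg _) (Ne.symm ?_)
  rwa [ne_eq, dotProduct_self_eq_zero]

theorem dotProduct_of_sameSupport {k l : K} (h : k ≠ l) (hs : SameSupport (x k) (x l)) :
    x k ⬝ᵥ x l = 0 :=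
  hs.dotProduct_eq_zero (hx.ne_of_ne h) (hx.ne_neg_of_ne h)

theorem dotProduct_of_ne_zero {k l : K} (h : k ≠ l) {t : ι} (hk : x k t ≠ 0) (hl : x l t ≠ 0)
    (hs : ¬ SameSupport (x k) (x l)) : x k ⬝ᵥ x l = -1 := by
  have h1 := hx.dotProduct_nonpos k l h
  rcases eq_one_or_of_abs (abs_dotProduct_eq_one (hx.short_or_long k) (hx.short_or_long l)
    hk hl hs) with h2 | h2
  · linarith
  · exact h2

theorem adj_of_ne_zero {k l : K} (h : k ≠ l) {t : ι} (hk : x k t ≠ 0) (hl : x l t ≠ 0)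
    (hs : ¬ SameSupport (x k) (x l)) : (dotGraph x).Adj k l := by
  rw [dotGraph_adj, hx.dotProduct_of_ne_zero h hk hl hs]
  exact ⟨h, by norm_num⟩

theorem not_sameSupport_of_adj {k l : K} (h : (dotGraph x).Adj k l) :
    ¬ SameSupport (x k) (x l) :=
  fun hs ↦ h.2 (hx.dotProduct_of_sameSupport h.1 hs)

omit hx in
theorem exists_common_of_adj {k l : K} (h : (dotGraph x).Adj k l) :
    ∃ t, x k t ≠ 0 ∧ x l t ≠ 0 := by
  obtain ⟨t, -, ht⟩ := Finset.exists_ne_zero_of_sum_ne_zero h.2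
  exact ⟨t, left_ne_zero_of_mul ht, right_ne_zero_of_mul ht⟩

theorem dotProduct_of_adj {k l : K} (h : (dotGraph x).Adj k l) : x k ⬝ᵥ x l = -1 := by
  obtain ⟨t, hk, hl⟩ := exists_common_of_adj h
  exact hx.dotProduct_of_ne_zero h.1 hk hl (hx.not_sameSupport_of_adj h)

omit hx in
theorem dotProduct_of_not_adj {k l : K} (h : k ≠ l) (h' : ¬ (dotGraph x).Adj k l) :
    x k ⬝ᵥ x l = 0 := by
  by_contra h0
  exact h' ⟨h, h0⟩

theorem no_triangle {k l m : K} (h1 : (dotGraph x).Adj k l) (h2 : (dotGraph x).Adj k m) :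
    ¬ (dotGraph x).Adj l m := by
  classical
  intro h3
  -- The diagonal contributes at most 6, the three edges contribute -6.
  have h := hx.sum_dotProduct_pos (s := {k, l, m}) (by simp)
  rw [Finset.sum_insert (by simp [h1.1, h2.1]), Finset.sum_pair h3.1] at h
  simp only [Finset.sum_insert (show k ∉ ({l, m} : Finset K) by simp [h1.1, h2.1]),
    Finset.sum_pair h3.1] at h
  have a1 := hx.dotProduct_of_adj h1
  have a2 := hx.dotProduct_of_adj h2
  have a3 := hx.dotProduct_of_adj h3
  have a4 := hx.dotProduct_of_adj h1.symm
  have a5 := hx.dotProduct_of_adj h2.symm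
  have a6 := hx.dotProduct_of_adj h3.symm
  have b1 := hx.self_le_two k
  have b2 := hx.self_le_two l
  have b3 := hx.self_le_two m
  linarith

/-- Two neighbours of a member `k` with a common non-zero coordinate coincide, unless they have the
same support. -/
theorem eq_of_common {k l m : K} (hl : (dotGraph x).Adj k l) (hm : (dotGraph x).Adj k m) {t : ι}
    (hlt : x l t ≠ 0) (hmt : x m t ≠ 0)
    (hs : l ≠ m → ¬ SameSupport (x l) (x m)) : l = m := by
  by_contra h
  exact hx.no_triangle hl hm (hx.adj_of_ne_zero h hlt hmt (hs h))

/-- Each neighbour of `k` shares one of its at most two non-zero coordinates; among three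
neighbours, two share the same one and therefore coincide. -/
theorem hasDegreeLeTwo (hs : ∀ k l, k ≠ l → ¬ SameSupport (x k) (x l)) :
    HasDegreeLeTwo (dotGraph x) := by
  intro k l m p hl hm hp
  obtain ⟨i, j, hij⟩ := exists_support_subset_pair (hx.short_or_long k)
  obtain ⟨a, ha, ha'⟩ := exists_common_of_adj hl
  obtain ⟨b, hb, hb'⟩ := exists_common_of_adj hm
  obtain ⟨c, hc, hc'⟩ := exists_common_of_adj hp
  have key : a = b ∨ a = c ∨ b = c := by
    have h1 := hij a ha
    have h2 := hij b hb
    have h3 := hij c hc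
    grind
  rcases key with rfl | rfl | rfl
  · exact Or.inl (hx.eq_of_common hl hm ha' hb' (hs l m))
  · exact Or.inr (Or.inl (hx.eq_of_common hl hp ha' hc' (hs l p)))
  · exact Or.inr (Or.inr (hx.eq_of_common hm hp hb' hc' (hs m p)))

theorem leaf_of_isShort (hs : ∀ k l, k ≠ l → ¬ SameSupport (x k) (x l)) {k : K}
    (hk : IsShort (x k)) (l m : K) (hl : (dotGraph x).Adj k l) (hm : (dotGraph x).Adj k m) :
    l = m := by
  obtain ⟨a, ha, ha'⟩ := exists_common_of_adj hl
  obtain ⟨b, hb, hb'⟩ := exists_common_of_adj hm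
  obtain ⟨i, -, h0⟩ := hk
  have hai : a = i := by by_contra h; exact ha (h0 a h)
  have hbi : b = i := by by_contra h; exact hb (h0 b h)
  subst hai hbi
  exact hx.eq_of_common hl hm ha' hb' (hs l m)

/-- If every vertex had two neighbours, every row sum of the Gram matrix would be at most 2 - 1 - 1
= 0, contradicting positivity. -/
theorem exists_leaf [Fintype K] [Nonempty K] :
    ∃ k, ∀ l m, (dotGraph x).Adj k l → (dotGraph x).Adj k m → l = m := by
  classical
  by_contra! h
  have hpos := hx.sum_dotProduct_pos (Finset.univ_nonempty (α := K))
  refine hpos.not_ge (Finset.sum_nonpos fun k _ ↦ ?_)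
  obtain ⟨l, m, hl, hm, hlm⟩ := h k
  have h1 : ∑ i ∈ ({k, l, m} : Finset K), -(x k ⬝ᵥ x i) ≤ ∑ i, -(x k ⬝ᵥ x i) := by
    refine Finset.sum_le_sum_of_subset_of_nonneg (Finset.subset_univ _) fun i _ hi ↦ ?_
    have : k ≠ i := by rintro rfl; simp at hi
    linarith [hx.dotProduct_nonpos k i this]
  rw [Finset.sum_insert (by simp [hl.1, hm.1]), Finset.sum_pair hlm, Finset.sum_neg_distrib,
    hx.dotProduct_of_adj hl, hx.dotProduct_of_adj hm] at h1
  linarith [hx.self_le_two k]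

end IsSimpleSystem

end System

/-! ### Cores: subfamilies spanning their coordinate vectors -/

section Core

variable {K ι : Type*} [DecidableEq ι]

/-- A set of members of a family of vectors whose span contains all coordinate vectors that
correspond to non-zero coordinates of these members. -/
def IsCore (x : K → ι → ℝ) (C : Set K) : Prop :=
  ∀ k ∈ C, ∀ t, x k t ≠ 0 → Pi.single t (1 : ℝ) ∈ Submodule.span ℝ (x '' C)

variable {x : K → ι → ℝ}

theorem IsCore.singleton {k : K} (hk : IsShort (x k)) : IsCore x {k} := by
  rintro l rfl t ht
  obtain ⟨i, hi, h0⟩ := hk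
  have hti : t = i := by by_contra h; exact ht (h0 t h)
  subst hti
  rw [Set.image_singleton, Submodule.mem_span_singleton]
  refine ⟨x l t, ?_⟩
  funext s
  by_cases hs : s = t
  · subst hs
    rw [Pi.smul_apply, smul_eq_mul, ← abs_mul_abs_self, hi, one_mul, Pi.single_eq_same]
  · simp [h0 s hs, hs]

/-- The coordinate vector at `a` is already in the span; removing it from `x f` isolates the other
coordinate. -/
theorem isCore_insert {C : Set K} (hC : IsCore x C) {k f : K} (hf : IsShort (x f) ∨ IsLong (x f))
    (hk : k ∈ C) {a : ι} (hka : x k a ≠ 0) (hfa : x f a ≠ 0) : IsCore x (insert f C) := by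
  have hmono : Submodule.span ℝ (x '' C) ≤ Submodule.span ℝ (x '' insert f C) :=
    Submodule.span_mono (Set.image_mono (Set.subset_insert f C))
  rintro l (rfl | hl) t ht
  · exact single_mem_of_other hf
      (Submodule.subset_span (Set.mem_image_of_mem _ (Set.mem_insert _ _))) hfa
      (hmono (hC k hk a hka)) ht
  · exact hmono (hC l hl t ht)

end Core

/-! ### Uniqueness of short vectors and of conjugate pairs -/

section System

variable {K ι : Type*} [Fintype ι]

namespace IsSimpleSystem

variable {x : K → ι → ℝ} (hx : IsSimpleSystem x)
include hx

section Core

variable [DecidableEq ι]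

theorem core_pair {p q : K} (hpq : p ≠ q) (hs : SameSupport (x p) (x q)) :
    IsCore x {p, q} := by
  have main : ∀ t, x p t ≠ 0 → Pi.single t (1 : ℝ) ∈ Submodule.span ℝ (x '' {p, q}) := by
    intro i hi
    have hdot := hx.dotProduct_of_sameSupport hpq hs
    have hxp := hx.short_or_long p
    have hxq := hx.short_or_long q
    obtain ⟨j, hij, hj⟩ : ∃ j, i ≠ j ∧ x p j ≠ 0 := by
      obtain ⟨a, b, hab, ha, hb, -⟩ := hs.isLong_left
      by_cases h : i = a
      · exact ⟨b, h ▸ hab, ne_zero_of_abs hb⟩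
      · exact ⟨a, h, ne_zero_of_abs ha⟩
    have hi' := (hs.ne_zero_iff i).mp hi
    have hj' := (hs.ne_zero_iff j).mp hj
    rw [dotProduct_eq_of_support_pair hij fun k h1 h2 ↦
      eq_zero_of_two_ne_zero hxp hij hi hj h1 h2] at hdot
    rw [Set.image_pair, Submodule.mem_span_pair]
    -- Expansion of the `i`-th coordinate vector in the orthogonal basis `x p`, `x q` of a
    -- coordinate plane, both of squared length 2.
    refine ⟨x p i / 2, x q i / 2, ?_⟩
    have e1 : x p i * x p i = 1 := by
      rw [← abs_mul_abs_self, abs_eq_one_of_ne_zero hxp hi, one_mul]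
    have e2 : x q i * x q i = 1 := by
      rw [← abs_mul_abs_self, abs_eq_one_of_ne_zero hxq hi', one_mul]
    have e3 : x p j * x p j = 1 := by
      rw [← abs_mul_abs_self, abs_eq_one_of_ne_zero hxp hj, one_mul]
    funext s
    by_cases hsi : s = i
    · subst hsi
      simp only [Pi.add_apply, Pi.smul_apply, smul_eq_mul, Pi.single_eq_same]
      linear_combination e1 / 2 + e2 / 2
    by_cases hsj : s = j
    · subst hsj
      simp only [Pi.add_apply, Pi.smul_apply, smul_eq_mul, Pi.single_eq_of_ne hsi]
      linear_combination (x p s * x q i / 2) * hdot - (x p i * x p s / 2) * e2 -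
        (x q i * x q s / 2) * e3
    · simp [eq_zero_of_two_ne_zero hxp hij hi hj hsi hsj,
        eq_zero_of_two_ne_zero hxq hij hi' hj' hsi hsj, hsi]
  rintro k (rfl | rfl) t ht
  · exact main t ht
  · exact main t ((hs.ne_zero_iff t).mpr ht)

/-- Disjoint subfamilies of an independent family have spans meeting only in 0, yet both spans would
contain the coordinate vector at `a`. -/
theorem not_disjoint_of_core {C D : Set K} (hC : IsCore x C) (hD : IsCore x D) {k l : K}
    (hk : k ∈ C) (hl : l ∈ D) {a : ι} (hka : x k a ≠ 0) (hla : x l a ≠ 0) : ¬ Disjoint C D := by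
  intro h
  have h1 := hx.linearIndependent.disjoint_span_image h
  have h2 := Submodule.disjoint_def.mp h1 _ (hC k hk a hka) (hD l hl a hla)
  simpa using congrFun h2 a

theorem mem_core {C : Set K} (hC : IsCore x C) {l : K}
    (h : ∀ t, x l t ≠ 0 → ∃ k ∈ C, x k t ≠ 0) : l ∈ C := by
  by_contra hl
  refine hx.linearIndependent.notMem_span_image hl ?_
  rw [pi_eq_sum_univ (x l)]
  refine Submodule.sum_mem _ fun t _ ↦ ?_
  by_cases ht : x l t = 0
  · simp [ht]
  · obtain ⟨k, hk, hkt⟩ := h t ht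
    have := hC k hk t hkt
    refine Submodule.smul_mem _ _ ?_
    convert this using 1
    funext s
    simp [Pi.single_apply, eq_comm]

/-- In a connected system, no two non-empty cores are disjoint. -/
theorem not_disjoint_cores [Finite K] (hc : (dotGraph x).Connected) {C D : Set K}
    (hC : IsCore x C) (hD : IsCore x D) (hCn : C.Nonempty) (hDn : D.Nonempty) :
    ¬ Disjoint C D := by
  intro hdis
  -- A walk from `C` to `D` must leave a maximal core `A` disjoint from `D`. The vertex where it
  -- does so either lies in `D`, giving a coordinate common to two cores, or can be added to `A`.
  obtain ⟨A, hCA, hA⟩ := Set.Finite.exists_le_maximal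
    (Set.toFinite {A : Set K | IsCore x A ∧ Disjoint A D}) (a := C) ⟨hC, hdis⟩
  obtain ⟨k, hk⟩ := hCn
  obtain ⟨l, hl⟩ := hDn
  obtain ⟨w⟩ := hc.preconnected k l
  obtain ⟨d, -, hd1, hd2⟩ := w.exists_boundary_dart A (hCA hk)
    (fun h ↦ Set.disjoint_left.mp hA.prop.2 h hl)
  obtain ⟨a, ha1, ha2⟩ := exists_common_of_adj d.adj
  by_cases hD' : d.snd ∈ D
  · exact hx.not_disjoint_of_core hA.prop.1 hD hd1 hD' ha1 ha2 hA.prop.2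
  · refine hd2 (hA.le_of_ge (y := insert d.snd A) ⟨isCore_insert hA.prop.1
      (hx.short_or_long _) hd1 ha1 ha2, ?_⟩ (Set.subset_insert _ _) (Set.mem_insert _ _))
    rw [Set.disjoint_insert_left]
    exact ⟨hD', hA.prop.2⟩

end Core

variable [Fintype K] (hc : (dotGraph x).Connected)
include hc

theorem eq_of_isShort {k l : K} (hk : IsShort (x k)) (hl : IsShort (x l)) : k = l := by
  classical
  by_contra h
  exact hx.not_disjoint_cores hc (IsCore.singleton hk) (IsCore.singleton hl)
    (Set.singleton_nonempty _) (Set.singleton_nonempty _) (by simpa using h)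

theorem not_sameSupport_of_isShort {s k l : K} (hs : IsShort (x s)) (hkl : k ≠ l) :
    ¬ SameSupport (x k) (x l) := by
  classical
  intro h
  have hne : ∀ {m}, IsLong (x m) → s ≠ m := by
    rintro m hm rfl
    have := hs.dotProduct_self
    rw [hm.dotProduct_self] at this
    norm_num at this
  refine hx.not_disjoint_cores hc (IsCore.singleton hs) (hx.core_pair hkl h)
    (Set.singleton_nonempty _) (Set.insert_nonempty _ _) ?_
  simpa using ⟨(hne h.isLong_left), (hne h.symm.isLong_left)⟩

/-- Both pairs are cores, so they meet; then the support of `x k` is covered by the first core,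
which must contain `k`. -/
theorem mem_pair_of_sameSupport {p q k l : K} (hpq : p ≠ q) (hs : SameSupport (x p) (x q))
    (hkl : k ≠ l) (hs' : SameSupport (x k) (x l)) : k = p ∨ k = q := by
  classical
  have hC := hx.core_pair hpq hs
  have hnd := hx.not_disjoint_cores hc hC (hx.core_pair hkl hs')
    (Set.insert_nonempty _ _) (Set.insert_nonempty _ _)
  obtain ⟨m, hm, hm'⟩ := Set.not_disjoint_iff.mp hnd
  refine hx.mem_core hC fun t ht ↦ ⟨m, hm, ?_⟩
  rcases hm' with rfl | rfl
  · exact ht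
  · exact (hs'.ne_zero_iff t).mp ht

theorem adj_right_of_adj_left {p q f : K} (hpq : p ≠ q) (hs : SameSupport (x p) (x q))
    (hf : (dotGraph x).Adj p f) : (dotGraph x).Adj q f := by
  obtain ⟨t, ht, ht'⟩ := exists_common_of_adj hf
  have hfq : q ≠ f := by
    rintro rfl
    exact hf.2 (hx.dotProduct_of_sameSupport hpq hs)
  refine hx.adj_of_ne_zero hfq ((hs.ne_zero_iff t).mp ht) ht' fun h ↦ ?_
  rcases hx.mem_pair_of_sameSupport hc hpq hs hfq.symm h.symm with h' | h'
  · exact hf.1 h'.symm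
  · exact hfq h'.symm

/-- Two members with the same support have at most one neighbour. -/
theorem leaf_of_sameSupport {p q : K} (hpq : p ≠ q) (hs : SameSupport (x p) (x q)) (f g : K)
    (hf : (dotGraph x).Adj p f) (hg : (dotGraph x).Adj p g) : f = g := by
  classical
  by_contra hfg
  have hf' := hx.adj_right_of_adj_left hc hpq hs hf
  have hg' := hx.adj_right_of_adj_left hc hpq hs hg
  -- The vertices `p`, `q`, `f`, `g` form a 4-cycle: diagonal at most 8, edges -8, and the remaining
  -- products are non-positive.
  have h := hx.sum_dotProduct_pos (s := {p, q, f, g}) (by simp)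
  simp only [Finset.sum_insert (show p ∉ ({q, f, g} : Finset K) by simp [hpq, hf.1, hg.1]),
    Finset.sum_insert (show q ∉ ({f, g} : Finset K) by simp [hf'.1, hg'.1]),
    Finset.sum_pair hfg] at h
  have a1 := hx.dotProduct_of_adj hf
  have a2 := hx.dotProduct_of_adj hg
  have a3 := hx.dotProduct_of_adj hf'
  have a4 := hx.dotProduct_of_adj hg'
  have a5 := hx.dotProduct_of_adj hf.symm
  have a6 := hx.dotProduct_of_adj hg.symm
  have a7 := hx.dotProduct_of_adj hf'.symm
  have a8 := hx.dotProduct_of_adj hg'.symm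
  have a9 := hx.dotProduct_of_sameSupport hpq hs
  have a10 := hx.dotProduct_of_sameSupport hpq.symm hs.symm
  have a11 := hx.dotProduct_nonpos f g hfg
  have a12 := hx.dotProduct_nonpos g f (Ne.symm hfg)
  linarith [hx.self_le_two p, hx.self_le_two q, hx.self_le_two f, hx.self_le_two g]

/-- A connected system containing two members with the same support has at least three members. -/
theorem three_le_card {p q : K} (hpq : p ≠ q) (hs : SameSupport (x p) (x q)) :
    3 ≤ Fintype.card K := by
  classical
  obtain ⟨c, hpc⟩ := exists_adj_of_ne hc hpq
  have hqc := hx.adj_right_of_adj_left hc hpq hs hpc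
  have h3 : ({p, q, c} : Finset K).card = 3 := by
    rw [Finset.card_eq_three]
    exact ⟨p, q, c, hpq, hpc.1, hqc.1, rfl⟩
  rw [← h3]
  exact Finset.card_le_univ _

end IsSimpleSystem

end System

/-! ### Cartan matrices of simple systems -/

section Numbering

variable {K ι : Type*} [Fintype ι] [Fintype K]

/-- With respect to some numbering of the index set, the matrix with entries
`2 (x k, x l) / (x l, x l)` is `C`. -/
def HasCartanNumbering (x : K → ι → ℝ) (C : ∀ n, Matrix (Fin n) (Fin n) ℤ) : Prop :=
  ∃ e : K ≃ Fin (Fintype.card K),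
    ∀ k l, 2 * (x k ⬝ᵥ x l) = (C (Fintype.card K) (e k) (e l) : ℝ) * (x l ⬝ᵥ x l)

namespace IsSimpleSystem

variable {x : K → ι → ℝ} (hx : IsSimpleSystem x) (hc : (dotGraph x).Connected)
include hx hc

theorem exists_path_numbering_of_hasDegreeLeTwo (h2 : HasDegreeLeTwo (dotGraph x)) :
    ∃ e : K ≃ Fin (Fintype.card K), ∀ k l,
      (dotGraph x).Adj k l ↔ (e k).val + 1 = (e l).val ∨ (e l).val + 1 = (e k).val := by
  have := hc.nonempty
  obtain ⟨u, hu⟩ := hx.exists_leaf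
  obtain ⟨e, -, he⟩ := exists_path_numbering hc h2 hu
  exact ⟨e, he⟩

/-- The hypothesis is a degree bound rather than distinctness of supports, so that the rank 3 system
with a conjugate pair (D_3 = A_3) is included. -/
theorem hasCartanNumbering_A (hl : ∀ k, IsLong (x k)) (h2 : HasDegreeLeTwo (dotGraph x)) :
    HasCartanNumbering x CartanMatrix.A := by
  classical
  obtain ⟨e, he⟩ := hx.exists_path_numbering_of_hasDegreeLeTwo hc h2
  refine ⟨e, fun k l ↦ ?_⟩
  rw [(hl l).dotProduct_self]
  by_cases hkl : k = l
  · subst hkl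
    simp [CartanMatrix.A, (hl k).dotProduct_self]
  · have hA : CartanMatrix.A (Fintype.card K) (e k) (e l) =
        if (dotGraph x).Adj k l then -1 else 0 := by
      simp only [CartanMatrix.A, Matrix.of_apply, EmbeddingLike.apply_eq_iff_eq, hkl, if_false]
      grind
    rw [hA]
    by_cases h : (dotGraph x).Adj k l
    · simp [h, hx.dotProduct_of_adj h]
    · simp [h, dotProduct_of_not_adj hkl h]

theorem hasCartanNumbering_B {s : K} (hs : IsShort (x s)) :
    HasCartanNumbering x CartanMatrix.B := by
  classical
  have hns : ∀ k l, k ≠ l → ¬ SameSupport (x k) (x l) := fun k l hkl ↦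
    hx.not_sameSupport_of_isShort hc hs hkl
  obtain ⟨e, hes, he⟩ := exists_path_numbering hc (hx.hasDegreeLeTwo hns)
    (hx.leaf_of_isShort hns hs)
  have hlast : ∀ l, (e l).val = Fintype.card K - 1 ↔ l = s := by
    intro l
    rw [← e.apply_eq_iff_eq, Fin.ext_iff]
    omega
  have hlong : ∀ l, l ≠ s → IsLong (x l) := fun l hl ↦
    (hx.short_or_long l).resolve_left fun h ↦ hl (hx.eq_of_isShort hc h hs)
  refine ⟨e, fun k l ↦ ?_⟩
  by_cases hkl : k = l
  · subst hkl
    simp [CartanMatrix.B]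
  -- Entries divide by the squared length of the column vector, which is 1 for `s` and 2 otherwise;
  -- hence -2 exactly in the column of `s`.
  have hB : CartanMatrix.B (Fintype.card K) (e k) (e l) =
      if (dotGraph x).Adj k l then if l = s then -2 else -1 else 0 := by
    simp only [CartanMatrix.B, Matrix.of_apply, EmbeddingLike.apply_eq_iff_eq, hkl, if_false]
    have h1 := he k l
    have h2 := hlast l
    have h3 := (e k).isLt
    have h4 := (e l).isLt
    grind
  rw [hB]
  by_cases h : (dotGraph x).Adj k l
  · rw [hx.dotProduct_of_adj h]
    by_cases hls : l = s
    · subst hls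
      simp [h, hs.dotProduct_self]
    · simp [h, hls, (hlong l hls).dotProduct_self]
  · simp [h, dotProduct_of_not_adj hkl h]

/-- A connected system of long vectors containing two members `p`, `q` with the same support is a
path ending in `p`, to which `q` is attached at the same neighbour. -/
theorem hasCartanNumbering_D (hl : ∀ k, IsLong (x k)) {p q : K} (hpq : p ≠ q)
    (hs : SameSupport (x p) (x q)) : HasCartanNumbering x CartanMatrix.D := by
  classical
  have hcard := hx.three_le_card hc hpq hs
  obtain ⟨c, hpc⟩ := exists_adj_of_ne hc hpq
  have hqc := hx.adj_right_of_adj_left hc hpq hs hpc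
  -- Since `q` is a leaf, deleting it keeps the graph connected; since the conjugate pair is unique,
  -- the remaining supports are distinct.
  have hq1 : (dotGraph x).degree q = 1 := SimpleGraph.degree_eq_one_iff_existsUnique_adj.mpr
    ⟨c, hqc, fun f hf ↦ hx.leaf_of_sameSupport hc hpq.symm hs.symm f c hf hqc⟩
  let y : ({q}ᶜ : Set K) → ι → ℝ := x ∘ Subtype.val
  have hy : IsSimpleSystem y := hx.comp_injective Subtype.val_injective
  have hadj : ∀ k l, (dotGraph y).Adj k l ↔ (dotGraph x).Adj k.1 l.1 := by
    intro k l
    simp [dotGraph_adj, y, Subtype.ext_iff]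
  have hcy : (dotGraph y).Connected := by
    have h := hc.induce_compl_singleton_of_degree_eq_one hq1
    convert h using 1
    ext k l
    simp [hadj]
  have hns : ∀ k l, k ≠ l → ¬ SameSupport (y k) (y l) := by
    intro k l hkl h
    have hkl' : k.1 ≠ l.1 := fun h' ↦ hkl (Subtype.ext h')
    have h1 := (hx.mem_pair_of_sameSupport hc hpq hs hkl' h).resolve_right k.2
    have h2 := (hx.mem_pair_of_sameSupport hc hpq hs hkl'.symm h.symm).resolve_right l.2
    exact hkl' (h1.trans h2.symm)
  obtain ⟨e, hep, he⟩ := exists_path_numbering (u := ⟨p, hpq⟩) hcy (hy.hasDegreeLeTwo hns)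
    (fun l m h1 h2 ↦ Subtype.ext (hx.leaf_of_sameSupport hc hpq hs _ _ ((hadj _ _).mp h1)
      ((hadj _ _).mp h2)))
  have hcardy : Fintype.card ({q}ᶜ : Set K) + 1 = Fintype.card K := by
    rw [Fintype.card_compl_set, Set.card_singleton]
    omega
  -- `q` takes the last number; `p` is then second to last and the common neighbour `c` third to
  -- last, as in the fork of D.
  let f : K → Fin (Fintype.card K) := fun k ↦
    if h : k = q then ⟨Fintype.card K - 1, by omega⟩
    else ⟨(e ⟨k, h⟩).val, by have := (e ⟨k, h⟩).isLt; omega⟩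
  have hfq : (f q).val + 1 = Fintype.card K := by
    simp only [f, dif_pos]
    omega
  have hf : ∀ k (h : k ≠ q), (f k).val = (e ⟨k, h⟩).val := by
    intro k h
    simp only [f, dif_neg h]
  have hflt : ∀ k, k ≠ q → (f k).val + 1 < Fintype.card K := by
    intro k h
    rw [hf k h]
    have := (e ⟨k, h⟩).isLt
    omega
  have hfinj : Function.Injective f := by
    intro k l hkl
    have hkl' := congrArg Fin.val hkl
    by_cases hk : k = q
    · by_contra hne
      subst hk
      have := hflt l (Ne.symm hne)
      omega
    · by_cases hlq : l = q
      · subst hlq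
        have := hflt k hk
        omega
      · rw [hf k hk, hf l hlq] at hkl'
        exact congrArg Subtype.val (e.injective (Fin.ext hkl'))
  have hfp : (f p).val + 2 = Fintype.card K := by
    rw [hf p hpq]
    omega
  have hfadj : ∀ k l, k ≠ q → l ≠ q → ((dotGraph x).Adj k l ↔
      (f k).val + 1 = (f l).val ∨ (f l).val + 1 = (f k).val) := by
    intro k l hk hlq
    rw [hf k hk, hf l hlq, ← he, hadj]
  have hcq : c ≠ q := hqc.1.symm
  have hfc : (f c).val + 3 = Fintype.card K := by
    have h1 := (hfadj p c hpq hcq).mp hpc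
    have h2 := hflt c hcq
    omega
  have hqadj : ∀ l, (dotGraph x).Adj q l ↔ (f l).val + 3 = Fintype.card K := by
    intro l
    constructor
    · intro h
      rwa [hx.leaf_of_sameSupport hc hpq.symm hs.symm l c h hqc]
    · intro h
      have : l = c := hfinj (Fin.ext (by omega))
      rwa [this]
  refine ⟨Equiv.ofBijective f ((Fintype.bijective_iff_injective_and_card f).mpr
    ⟨hfinj, by simp⟩), fun k l ↦ ?_⟩
  simp only [Equiv.ofBijective_apply]
  rw [(hl l).dotProduct_self]
  by_cases hkl : k = l
  · subst hkl
    simp [CartanMatrix.D, (hl k).dotProduct_self]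
  have hD : CartanMatrix.D (Fintype.card K) (f k) (f l) =
      if (dotGraph x).Adj k l then -1 else 0 := by
    have hne : f k ≠ f l := hfinj.ne hkl
    have hne' : (f k).val ≠ (f l).val := fun h ↦ hne (Fin.ext h)
    simp only [CartanMatrix.D, Matrix.of_apply, hne, if_false]
    by_cases hk : k = q
    · subst hk
      have := hqadj l
      have := hflt l (Ne.symm hkl)
      grind
    · by_cases hlq : l = q
      · subst hlq
        have h1 := hqadj k
        rw [SimpleGraph.adj_comm] at h1
        have := hflt k hkl
        grind
      · have := hfadj k l hk hlq
        have := hflt k hk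
        have := hflt l hlq
        grind
  rw [hD]
  by_cases h : (dotGraph x).Adj k l
  · simp [h, hx.dotProduct_of_adj h]
  · simp [h, dotProduct_of_not_adj hkl h]

/-- A connected system of long vectors with pairwise different supports is orthogonal to a vector
without zero coordinates. -/
theorem exists_orthogonal (hl : ∀ k, IsLong (x k))
    (hns : ∀ k l, k ≠ l → ¬ SameSupport (x k) (x l)) :
    ∃ ε : ι → ℝ, (∀ t, ε t ≠ 0) ∧ ∀ k, ε ⬝ᵥ x k = 0 := by
  classical
  obtain ⟨e, he⟩ := hx.exists_path_numbering_of_hasDegreeLeTwo hc (hx.hasDegreeLeTwo hns)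
  -- The vector is corrected one member at a time along the path.
  have key : ∀ m : ℕ, ∃ ε : ι → ℝ, (∀ t, ε t ≠ 0) ∧ ∀ k, (e k).val < m → ε ⬝ᵥ x k = 0 := by
    intro m
    induction m with
    | zero => exact ⟨1, by simp, by simp⟩
    | succ m ih =>
      obtain ⟨ε, hε, hεk⟩ := ih
      by_cases hm : ∃ k, (e k).val = m
      swap
      · push Not at hm
        exact ⟨ε, hε, fun k hk ↦ hεk k (by have := hm k; omega)⟩
      obtain ⟨k, hk⟩ := hm
      -- Some coordinate `b` of `x k` is unused by earlier members: an earlier member sharing a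
      -- coordinate with `k` is its unique predecessor on the path, and it cannot share both.
      obtain ⟨a, b, hab, ha, hb, h0, hfree⟩ : ∃ a b, a ≠ b ∧ x k a ≠ 0 ∧ x k b ≠ 0 ∧
          (∀ t, t ≠ a → t ≠ b → x k t = 0) ∧ ∀ l, (e l).val < m → x l b = 0 := by
        obtain ⟨i, j, hij, hi, hj, h0⟩ := hl k
        have hi := ne_zero_of_abs hi
        have hj := ne_zero_of_abs hj
        by_cases hfi : ∀ l, (e l).val < m → x l i = 0
        · exact ⟨j, i, hij.symm, hj, hi, fun t h1 h2 ↦ h0 t h2 h1, hfi⟩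
        refine ⟨i, j, hij, hi, hj, h0, fun l hlm ↦ ?_⟩
        by_contra hlj
        push Not at hfi
        obtain ⟨l', hl'm, hl'i⟩ := hfi
        have h1 : k ≠ l := by rintro rfl; omega
        have h2 : k ≠ l' := by rintro rfl; omega
        have h3 := (he k l).mp (hx.adj_of_ne_zero h1 hj hlj (hns k l h1))
        have h4 := (he k l').mp (hx.adj_of_ne_zero h2 hi hl'i (hns k l' h2))
        have h5 : l = l' := e.injective (Fin.ext (by omega))
        subst h5
        exact hns k l h1 (sameSupport_of_two_ne_zero (hx.short_or_long k) (hx.short_or_long l)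
          hij hi hj hl'i hlj)
      -- The new value solves `ε a * x k a + ε b * x k b = 0`; it is non-zero and does not disturb
      -- the earlier members.
      refine ⟨Function.update ε b (-(ε a * x k a) / x k b), fun t ↦ ?_, fun l hlm ↦ ?_⟩
      · by_cases htb : t = b
        · subst htb
          simp [ha, hb, hε]
        · simp [htb, hε]
      · by_cases hlk : l = k
        · subst hlk
          rw [dotProduct_comm, dotProduct_eq_of_support_pair hab h0, Function.update_self,
            Function.update_of_ne hab]
          field_simp
          ring
        · have hlm' : (e l).val < m := by
            have : (e l).val ≠ m := fun h ↦ hlk (e.injective (Fin.ext (h.trans hk.symm)))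
            omega
          rw [← hεk l hlm']
          refine Finset.sum_congr rfl fun t _ ↦ ?_
          by_cases htb : t = b
          · subst htb
            simp [hfree l hlm']
          · simp [htb]
  obtain ⟨ε, hε, h⟩ := key (Fintype.card K)
  exact ⟨ε, hε, fun k ↦ h k (e k).isLt⟩

end IsSimpleSystem

omit [Fintype K] in
-- Orthogonality to `ε` fixes the ratio of the two non-zero coordinates.
theorem SameSupport.eq_or_eq_neg_of_orthogonal {y z ε : ι → ℝ} (h : SameSupport y z)
    (hε : ∀ t, ε t ≠ 0) (hy : ε ⬝ᵥ y = 0) (hz : ε ⬝ᵥ z = 0) : y = z ∨ y = -z := by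
  obtain ⟨i, j, hij, hi, hj, hi', hj', h0⟩ := id h
  refine h.eq_or_eq_neg hij (ne_zero_of_abs hi) (ne_zero_of_abs hj) ?_
  rw [dotProduct_comm, dotProduct_eq_of_support_pair hij fun k a b ↦ (h0 k a b).1] at hy
  rw [dotProduct_comm, dotProduct_eq_of_support_pair hij fun k a b ↦ (h0 k a b).2] at hz
  refine mul_right_cancel₀ (hε j) ?_
  linear_combination y i * hz - z i * hy

end Numbering

/-! ### Translation between dual lattice and ℝ^ι -/

section EvalVec

variable {N : Type*} [AddCommGroup N] {ι : Type*} {v : ι → N} {α β : Dual ℤ N}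

theorem abs_evalVec_eq_one_iff (i : ι) : |evalVec v α i| = 1 ↔ |α (v i)| = 1 := by
  rw [evalVec, ← Int.cast_abs]
  exact_mod_cast Iff.rfl

theorem evalVec_eq_zero_iff (i : ι) : evalVec v α i = 0 ↔ α (v i) = 0 := by
  simp [evalVec]

theorem isShort_evalVec : IsShort (evalVec v α) ↔ IsType1 v α := by
  simp only [IsShort, IsType1, abs_evalVec_eq_one_iff, evalVec_eq_zero_iff]

theorem isLong_evalVec : IsLong (evalVec v α) ↔ IsType2 v α := by
  simp only [IsLong, IsType2, abs_evalVec_eq_one_iff, evalVec_eq_zero_iff]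

theorem isShort_or_isLong_evalVec (h : α ∈ rootSet v) :
    IsShort (evalVec v α) ∨ IsLong (evalVec v α) :=
  h.imp isShort_evalVec.mpr isLong_evalVec.mpr

theorem isConjugate_iff :
    IsConjugate v α β ↔ SameSupport (evalVec v α) (evalVec v β) ∧ LinearIndependent ℤ ![α, β] := by
  simp only [IsConjugate, SameSupport, abs_evalVec_eq_one_iff, evalVec_eq_zero_iff]

theorem IsShort.not_isLong [Fintype ι] {x : ι → ℝ} (hs : IsShort x) : ¬ IsLong x := by
  intro hl
  have := hs.dotProduct_self
  rw [hl.dotProduct_self] at this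
  norm_num at this

end EvalVec

/-! ### Subsystems as root systems, and their simple roots -/

namespace Subsystem

variable {N : Type*} [AddCommGroup N] [Module.Free ℤ N] [Module.Finite ℤ N]
    {ι : Type*} [Fintype ι] {v : ι → N}
    (hv : finrank ℤ (Submodule.span ℤ (Set.range v)) = finrank ℤ N) (Φ : Subsystem v)

include hv in
theorem finite_carrier : Finite Φ.carrier := by
  have hfin : (Set.univ.pi fun _ : ι ↦ ({0, 1, -1} : Set ℝ)).Finite :=
    Set.Finite.pi fun _ ↦ Set.toFinite _
  refine Set.Finite.of_finite_image (f := evalVec v) (hfin.subset ?_) (evalVec_injective hv).injOn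
  rintro _ ⟨α, hα, rfl⟩ i -
  by_cases h : evalVec v α i = 0
  · simp [h]
  · rcases eq_one_or_of_abs (abs_eq_one_of_ne_zero
      (isShort_or_isLong_evalVec (Φ.subset_rootSet hα)) h) with h | h <;> simp [h]

/-- A scalar relating two roots maps a coordinate ±1 to a coordinate ±1, so it is itself ±1. -/
theorem isReduced_rootPairing : (Φ.rootPairing hv).IsReduced := by
  refine ⟨fun α β h ↦ ?_⟩
  have hα := isShort_or_isLong_evalVec (Φ.subset_rootSet α.2)
  have hβ := isShort_or_isLong_evalVec (Φ.subset_rootSet β.2)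
  obtain ⟨i, hi⟩ : ∃ i, |evalVec v α.1 i| = 1 := by
    rcases hα with ⟨i, hi, -⟩ | ⟨i, -, -, hi, -⟩ <;> exact ⟨i, hi⟩
  obtain ⟨j, hj⟩ : ∃ j, |evalVec v β.1 j| = 1 := by
    rcases hβ with ⟨i, hi, -⟩ | ⟨i, -, -, hi, -⟩ <;> exact ⟨i, hi⟩
  change Φ.rootVec α = Φ.rootVec β ∨ Φ.rootVec α = -Φ.rootVec β
  change ¬ LinearIndependent ℝ ![Φ.rootVec α, Φ.rootVec β] at h
  rw [LinearIndependent.pair_iff' (fun h0 ↦ ne_zero_of_abs hi (congrFun (congrArg Subtype.val h0) i))]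
    at h
  push Not at h
  obtain ⟨a, ha⟩ := h
  have ha' : ∀ t, a * evalVec v α.1 t = evalVec v β.1 t :=
    fun t ↦ congrFun (congrArg Subtype.val ha) t
  have hj0 : evalVec v α.1 j ≠ 0 := by
    intro h0
    refine ne_zero_of_abs hj ?_
    rw [← ha', h0, mul_zero]
  have habs : |a| = 1 := by
    have := congrArg abs (ha' j)
    rwa [abs_mul, abs_eq_one_of_ne_zero hα hj0, hj, mul_one] at this
  rw [← ha]
  rcases eq_one_or_of_abs habs with rfl | rfl <;> simp

theorem isRootSystem_rootPairing : (Φ.rootPairing hv).IsRootSystem where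
  span_root_eq_top := by
    change Submodule.span ℝ (Set.range Φ.rootVec) = ⊤
    refine Submodule.map_injective_of_injective Φ.rootSpace.injective_subtype ?_
    rw [Submodule.map_span, Submodule.map_subtype_top, ← Set.range_comp]
    change _ = Submodule.span ℝ (evalVec v '' Φ.carrier)
    rw [Set.image_eq_range]
    rfl
  span_coroot_eq_top := by
    change Submodule.span ℝ (Set.range Φ.corootVec) = ⊤
    -- It suffices that no non-zero vector of the root space is killed by all coroots: such a vector
    -- is orthogonal to the root space, hence to itself.
    rw [← Subspace.dualCoannihilator_dualAnnihilator_eq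
      (W := Submodule.span ℝ (Set.range Φ.corootVec)), Submodule.dualAnnihilator_eq_top_iff,
      Submodule.eq_bot_iff]
    intro x hx
    rw [Submodule.mem_dualCoannihilator] at hx
    have horth : ∀ y ∈ Φ.rootSpace, x.1 ⬝ᵥ y = 0 := by
      intro y hy
      induction hy using Submodule.span_induction with
      | mem y hy =>
        obtain ⟨α, hα, rfl⟩ := hy
        have h : 2 / (form v α α : ℝ) * (x.1 ⬝ᵥ evalVec v α) = 0 :=
          hx _ (Submodule.subset_span ⟨⟨α, hα⟩, rfl⟩)
        have h0 : (form v α α : ℝ) ≠ 0 :=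
          Int.cast_ne_zero.mpr (form_self_ne_zero (Φ.subset_rootSet hα))
        exact (mul_eq_zero.mp h).resolve_left (div_ne_zero two_ne_zero h0)
      | zero => simp
      | add y z _ _ hy hz => rw [dotProduct_add, hy, hz, add_zero]
      | smul c y _ hy => rw [dotProduct_smul, hy, smul_zero]
    exact Subtype.ext (dotProduct_self_eq_zero.mp (horth x.1 x.2))

variable {Φ hv} (b : (Φ.rootPairing hv).Base)

/-- The simple roots of a base as vectors in `ℝ^ι`. -/
def simpleVec (k : b.support) : ι → ℝ :=
  evalVec v k.1.1

theorem cartanMatrix_mul_dotProduct (k l : b.support) :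
    (b.cartanMatrix k l : ℝ) * (simpleVec b l ⬝ᵥ simpleVec b l) =
      2 * (simpleVec b k ⬝ᵥ simpleVec b l) := by
  have h : (b.cartanMatrix k l : ℝ) = (cartanInt v k.1.1 l.1.1 : ℝ) := by
    have := b.algebraMap_cartanMatrixIn_apply ℤ k l
    exact this.trans (Φ.corootVec_rootVec l.1 k.1)
  rw [h, simpleVec, simpleVec, evalVec_dotProduct, evalVec_dotProduct]
  exact_mod_cast cartanInt_mul_form (Φ.subset_rootSet l.1.2) k.1.1

theorem dotProduct_self_pos (k : b.support) : 0 < simpleVec b k ⬝ᵥ simpleVec b k := by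
  rcases isShort_or_isLong_evalVec (Φ.subset_rootSet k.1.2) with h | h
  · rw [simpleVec, h.dotProduct_self]
    norm_num
  · rw [simpleVec, h.dotProduct_self]
    norm_num

theorem isSimpleSystem_simpleVec : IsSimpleSystem (simpleVec b) where
  short_or_long k := isShort_or_isLong_evalVec (Φ.subset_rootSet k.1.2)
  linearIndependent := b.linearIndepOn_root.linearIndependent.map' Φ.rootSpace.subtype
    (Submodule.ker_subtype _)
  dotProduct_nonpos k l hkl := by
    have := Φ.finite_carrier hv
    have h1 := b.cartanMatrix_le_zero_of_ne k l hkl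
    have h2 := cartanMatrix_mul_dotProduct b k l
    have h3 := dotProduct_self_pos b l
    have h4 : (b.cartanMatrix k l : ℝ) ≤ 0 := by exact_mod_cast h1
    nlinarith

theorem connected_dotGraph_simpleVec (hirr : (Φ.rootPairing hv).IsIrreducible) :
    (dotGraph (simpleVec b)).Connected := by
  have := Φ.finite_carrier hv
  have := Φ.isReduced_rootPairing hv
  have hne : Nonempty b.support := by
    by_contra hempty
    rw [not_nonempty_iff] at hempty
    have hcar : Φ.carrier = ∅ := by
      by_contra h
      have : Nonempty Φ.carrier := Set.nonempty_iff_ne_empty'.mpr h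
      obtain ⟨k, hk⟩ := b.support_nonempty
      exact hempty.elim ⟨k, hk⟩
    have h0 : Φ.rootSpace = ⊥ := by simp [rootSpace, hcar]
    have hnt := hirr.nontrivial
    exact (Submodule.nontrivial_iff_ne_bot.mp hnt) h0
  refine ⟨fun i j ↦ ?_⟩
  -- Irreducibility enters here: a property that spreads along non-zero Cartan entries reaches every
  -- simple root.
  refine b.induction_on_cartanMatrix (fun k ↦ (dotGraph (simpleVec b)).Reachable i k)
    (SimpleGraph.Reachable.refl i) fun k l hk hl ↦ ?_
  by_cases hkl : k = l
  · rwa [← hkl]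
  refine hk.trans (SimpleGraph.Adj.reachable (SimpleGraph.Adj.symm ⟨Ne.symm hkl, fun h0 ↦ hl ?_⟩))
  have h1 := cartanMatrix_mul_dotProduct b l k
  rw [h0, mul_zero] at h1
  exact_mod_cast (mul_eq_zero.mp h1).resolve_right (dotProduct_self_pos b k).ne'

theorem evalVec_mem_span_int (α : Φ.carrier) :
    evalVec v α.1 ∈ Submodule.span ℤ (Set.range (simpleVec b)) := by
  have h := Submodule.mem_map_of_mem (f := Φ.rootSpace.subtype.restrictScalars ℤ)
    (b.root_mem_span_int α)
  rw [Submodule.map_span, ← Set.image_comp, Set.image_eq_range] at h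
  exact h

theorem card_support : Fintype.card b.support = Φ.rank := by
  rw [← finrank_span_eq_card (isSimpleSystem_simpleVec b).linearIndependent]
  suffices h : Submodule.span ℝ (Set.range (simpleVec b)) =
      Submodule.span ℝ (evalVec v '' Φ.carrier) by
    rw [h]
    rfl
  refine le_antisymm (Submodule.span_mono ?_) (Submodule.span_le.mpr ?_)
  · rintro _ ⟨k, rfl⟩
    exact ⟨k.1.1, k.1.2, rfl⟩
  · rintro _ ⟨α, hα, rfl⟩
    have h := evalVec_mem_span_int b ⟨α, hα⟩
    exact Submodule.span_le_restrictScalars ℤ ℝ _ h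

/-- If all simple roots are of type 2 then all roots are of type 2. -/
theorem isType2_of_forall_support (h : ∀ α ∈ b.support, IsType2 v α.1) (α : Φ.carrier) :
    IsType2 v α.1 := by
  -- Parity of the coordinate sum: even for each long vector, hence on their integer span, but odd
  -- for a short vector.
  have key : ∀ y ∈ Submodule.span ℤ (Set.range (simpleVec b)), ∃ m : ℤ, ∑ i, y i = 2 * m := by
    intro y hy
    induction hy using Submodule.span_induction with
    | mem y hy =>
      obtain ⟨k, rfl⟩ := hy
      obtain ⟨i, j, hij, hi, hj, h0⟩ := isLong_evalVec.mpr (h k.1 k.2)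
      have hsum : ∑ t, simpleVec b k t = evalVec v k.1.1 i + evalVec v k.1.1 j :=
        Finset.sum_eq_add (a := i) (b := j) hij (fun t _ ht ↦ h0 t ht.1 ht.2) (by simp) (by simp)
      rw [hsum]
      rcases eq_one_or_of_abs hi with e1 | e1 <;> rcases eq_one_or_of_abs hj with e2 | e2 <;>
        rw [e1, e2]
      · exact ⟨1, by norm_num⟩
      · exact ⟨0, by norm_num⟩
      · exact ⟨0, by norm_num⟩
      · exact ⟨-1, by norm_num⟩
    | zero => exact ⟨0, by simp⟩
    | add y z _ _ hy hz =>
      obtain ⟨m, hm⟩ := hy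
      obtain ⟨n, hn⟩ := hz
      refine ⟨m + n, ?_⟩
      simp only [Pi.add_apply, Finset.sum_add_distrib, hm, hn]
      push_cast
      ring
    | smul c y _ hy =>
      obtain ⟨m, hm⟩ := hy
      refine ⟨c * m, ?_⟩
      rw [Finset.sum_congr rfl fun i _ ↦ Pi.smul_apply c y i, ← Finset.smul_sum, hm, zsmul_eq_mul]
      push_cast
      ring
  refine (Φ.subset_rootSet α.2).resolve_left fun h1 ↦ ?_
  obtain ⟨m, hm⟩ := key _ (evalVec_mem_span_int b α)
  obtain ⟨i, hi, h0⟩ := isShort_evalVec.mpr h1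
  rw [Finset.sum_eq_single i (fun t _ ht ↦ h0 t ht) (by simp)] at hm
  rcases eq_one_or_of_abs hi with e | e <;> rw [e] at hm
  · have : (1 : ℤ) = 2 * m := by exact_mod_cast hm
    omega
  · have : (-1 : ℤ) = 2 * m := by exact_mod_cast hm
    omega

theorem dotProduct_evalVec_eq_zero {ε : ι → ℝ} (h : ∀ k, ε ⬝ᵥ simpleVec b k = 0)
    (α : Φ.carrier) : ε ⬝ᵥ evalVec v α.1 = 0 := by
  have hα := evalVec_mem_span_int b α
  generalize evalVec v α.1 = y at hα
  induction hα using Submodule.span_induction with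
  | mem y hy =>
    obtain ⟨k, rfl⟩ := hy
    exact h k
  | zero => simp
  | add y z _ _ hy hz => rw [dotProduct_add, hy, hz, add_zero]
  | smul c y _ hy => rw [dotProduct_smul, hy, smul_zero]

/-- Distinct simple roots are independent over ℝ, so the independence clause of conjugacy reduces to
`k ≠ l`. -/
theorem isConjugate_iff_sameSupport (k l : b.support) :
    IsConjugate v k.1.1 l.1.1 ↔ k ≠ l ∧ SameSupport (simpleVec b k) (simpleVec b l) := by
  rw [isConjugate_iff, and_comm]
  refine and_congr_left fun _ ↦ ⟨?_, fun h ↦ ?_⟩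
  · rintro h rfl
    exact h.injective.ne (a₁ := 0) (a₂ := 1) (by simp) rfl
  · have h1 := b.linearIndependent_pair_of_ne h
    rw [LinearIndependent.pair_iff] at h1 ⊢
    intro s t hst
    have h2 := h1 s t ?_
    · exact_mod_cast h2
    · refine Subtype.ext (funext fun i ↦ ?_)
      have h3 := LinearMap.congr_fun hst (v i)
      change (s : ℝ) * (k.1.1 (v i) : ℤ) + (t : ℝ) * (l.1.1 (v i) : ℤ) = 0
      simp only [LinearMap.add_apply, LinearMap.smul_apply, smul_eq_mul, LinearMap.zero_apply] at h3
      exact_mod_cast h3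

theorem exists_isConjugate_iff :
    (∃ α ∈ b.support, ∃ β ∈ b.support, IsConjugate v α.1 β.1) ↔
      ∃ k l, k ≠ l ∧ SameSupport (simpleVec b k) (simpleVec b l) := by
  simp only [← isConjugate_iff_sameSupport b]
  exact ⟨fun ⟨α, hα, β, hβ, h⟩ ↦ ⟨⟨α, hα⟩, ⟨β, hβ⟩, h⟩, fun ⟨k, l, h⟩ ↦ ⟨k.1, k.2, l.1, l.2, h⟩⟩

theorem forall_isType2_iff :
    (∀ α ∈ b.support, IsType2 v α.1) ↔ ∀ k, IsLong (simpleVec b k) :=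
  ⟨fun h k ↦ isLong_evalVec.mpr (h k.1 k.2), fun h α hα ↦ isLong_evalVec.mp (h ⟨α, hα⟩)⟩

theorem hasCartanMatrix_of_numbering {C : ∀ n, Matrix (Fin n) (Fin n) ℤ}
    (h : HasCartanNumbering (simpleVec b) C) :
    HasCartanMatrix (Φ.rootPairing hv) (C Φ.rank) := by
  rw [← card_support b]
  obtain ⟨e, he⟩ := h
  refine ⟨b, e, ?_⟩
  ext i j
  obtain ⟨k, rfl⟩ := e.surjective i
  obtain ⟨l, rfl⟩ := e.surjective j
  have h1 := he k l
  rw [← cartanMatrix_mul_dotProduct] at h1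
  have h2 := mul_right_cancel₀ (dotProduct_self_pos b l).ne' h1
  simpa using (by exact_mod_cast h2 :
    b.cartanMatrix k l = C (Fintype.card b.support) (e k) (e l))

theorem exists_numbering_of_hasCartanMatrix {n : ℕ} {C : ∀ n, Matrix (Fin n) (Fin n) ℤ}
    (h : HasCartanMatrix (Φ.rootPairing hv) (C n)) :
    n = Φ.rank ∧ ∃ b : (Φ.rootPairing hv).Base, HasCartanNumbering (simpleVec b) C := by
  obtain ⟨b, e, he⟩ := h
  have hn : n = Fintype.card b.support := by
    rw [Fintype.card_congr e, Fintype.card_fin]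
  subst hn
  refine ⟨card_support b, b, e, fun k l ↦ ?_⟩
  rw [← cartanMatrix_mul_dotProduct, ← he]
  simp

end Subsystem

/-! ### Reading root lengths and degrees off a Cartan matrix -/

section Converse

variable {K ι : Type*} [Fintype ι] [Fintype K] {x : K → ι → ℝ}

theorem hasDegreeLeTwo_of_card_le_three {G : SimpleGraph K} (h : Fintype.card K ≤ 3) :
    HasDegreeLeTwo G := by
  classical
  intro k l m p hl hm hp
  by_contra! hne
  have hc : ({k, l, m, p} : Finset K).card = 4 := by
    rw [Finset.card_eq_succ]
    exact ⟨k, {l, m, p}, by simp [hl.ne, hm.ne, hp.ne], rfl,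
      Finset.card_eq_three.mpr ⟨l, m, p, hne.1, hne.2.1, hne.2.2, rfl⟩⟩
  have := Finset.card_le_univ ({k, l, m, p} : Finset K)
  omega

namespace IsSimpleSystem

variable (hx : IsSimpleSystem x)
include hx

/-- A short member with a neighbour would produce the entry 2 · (-1) / 1 = -2. -/
theorem isLong_of_hasCartanNumbering (hc : (dotGraph x).Connected) (h2 : 2 ≤ Fintype.card K)
    {C : ∀ n, Matrix (Fin n) (Fin n) ℤ} (hC : ∀ n i j, -1 ≤ C n i j)
    (h : HasCartanNumbering x C) (k : K) : IsLong (x k) := by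
  refine (hx.short_or_long k).resolve_left fun hs ↦ ?_
  have := Fintype.one_lt_card_iff_nontrivial.mp (show 1 < Fintype.card K by omega)
  obtain ⟨p, hp⟩ := exists_ne k
  obtain ⟨l, hl⟩ := exists_adj_of_ne hc hp.symm
  obtain ⟨e, he⟩ := h
  have h1 := he l k
  rw [hx.dotProduct_of_adj hl.symm, hs.dotProduct_self] at h1
  have h3 : ((-1 : ℤ) : ℝ) ≤ C (Fintype.card K) (e l) (e k) := Int.cast_le.mpr (hC _ _ _)
  push_cast at h3
  linarith

theorem exists_isShort_of_hasCartanNumbering_B (h2 : 2 ≤ Fintype.card K)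
    (h : HasCartanNumbering x CartanMatrix.B) : ∃ k, IsShort (x k) := by
  obtain ⟨e, he⟩ := h
  obtain ⟨k, hk⟩ := e.surjective ⟨Fintype.card K - 2, by omega⟩
  obtain ⟨l, hl⟩ := e.surjective ⟨Fintype.card K - 1, by omega⟩
  refine ⟨l, (hx.short_or_long l).resolve_right fun hlong ↦ ?_⟩
  have hkl : k ≠ l := by
    rintro rfl
    have := congrArg Fin.val (hk.symm.trans hl)
    simp only at this
    omega
  have h1 := he k l
  have hB : CartanMatrix.B (Fintype.card K) (e k) (e l) = -2 := by
    rw [hk, hl]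
    simp only [CartanMatrix.B, Matrix.of_apply, Fin.mk.injEq]
    rw [if_neg (by omega), if_pos (by omega), if_pos trivial]
  rw [hB, hlong.dotProduct_self] at h1
  push_cast at h1
  -- The entry -2 with `x l` long would force product -2, while adjacent members have product -1.
  have hadj : (dotGraph x).Adj k l := ⟨hkl, by linarith⟩
  rw [hx.dotProduct_of_adj hadj] at h1
  norm_num at h1

theorem dotGraph_adj_iff {C : ∀ n, Matrix (Fin n) (Fin n) ℤ} {e : K ≃ Fin (Fintype.card K)}
    (he : ∀ k l, 2 * (x k ⬝ᵥ x l) = (C (Fintype.card K) (e k) (e l) : ℝ) * (x l ⬝ᵥ x l)) {k l : K} :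
    (dotGraph x).Adj k l ↔ k ≠ l ∧ C (Fintype.card K) (e k) (e l) ≠ 0 := by
  rw [dotGraph_adj]
  refine and_congr_right fun _ ↦ not_congr ?_
  have h1 := he k l
  have h2 : x l ⬝ᵥ x l ≠ 0 := by
    rcases hx.short_or_long l with h | h <;> rw [h.dotProduct_self] <;> norm_num
  constructor
  · intro h
    rw [h, mul_zero] at h1
    exact_mod_cast (mul_eq_zero.mp h1.symm).resolve_right h2
  · intro h
    rw [h] at h1
    simpa using h1

theorem hasDegreeLeTwo_of_hasCartanNumbering_A (h : HasCartanNumbering x CartanMatrix.A) :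
    HasDegreeLeTwo (dotGraph x) := by
  obtain ⟨e, he⟩ := h
  have hadj : ∀ k l, (dotGraph x).Adj k l →
      (e k).val + 1 = (e l).val ∨ (e l).val + 1 = (e k).val := by
    intro k l hkl
    rw [hx.dotGraph_adj_iff he] at hkl
    by_contra h
    refine hkl.2 ?_
    simp only [CartanMatrix.A, Matrix.of_apply]
    rw [if_neg (e.injective.ne hkl.1), if_neg h]
  intro k l m p hl hm hp
  simp only [← e.apply_eq_iff_eq, Fin.ext_iff]
  have h1 := hadj k l hl
  have h2 := hadj k m hm
  have h3 := hadj k p hp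
  omega

/-- With indices from 0, the branch vertex is n - 3, with neighbours n - 4, n - 2 and n - 1; the
first of these needs n ≥ 4. -/
theorem not_hasDegreeLeTwo_of_hasCartanNumbering_D (h4 : 4 ≤ Fintype.card K)
    (h : HasCartanNumbering x CartanMatrix.D) : ¬ HasDegreeLeTwo (dotGraph x) := by
  obtain ⟨e, he⟩ := h
  intro h2
  obtain ⟨k, hk⟩ := e.surjective ⟨Fintype.card K - 3, by omega⟩
  obtain ⟨l, hl⟩ := e.surjective ⟨Fintype.card K - 4, by omega⟩
  obtain ⟨m, hm⟩ := e.surjective ⟨Fintype.card K - 2, by omega⟩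
  obtain ⟨p, hp⟩ := e.surjective ⟨Fintype.card K - 1, by omega⟩
  have hk' := congrArg Fin.val hk
  have hl' := congrArg Fin.val hl
  have hm' := congrArg Fin.val hm
  have hp' := congrArg Fin.val hp
  simp only at hk' hl' hm' hp'
  have hne : ∀ a b, (e a).val ≠ (e b).val → a ≠ b := fun a b hab h' ↦ hab (by rw [h'])
  have hadj : ∀ a, ((e a).val + 1 = Fintype.card K - 3 ∨ (e a).val + 2 = Fintype.card K ∨
      (e a).val + 1 = Fintype.card K) → (dotGraph x).Adj k a := by
    intro a ha
    rw [hx.dotGraph_adj_iff he]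
    refine ⟨hne _ _ (by omega), ?_⟩
    have hka : e k ≠ e a := fun h' ↦ by
      have := congrArg Fin.val h'
      omega
    simp only [CartanMatrix.D, Matrix.of_apply, if_neg hka]
    grind
  rcases h2 k l m p (hadj l (by omega)) (hadj m (by omega)) (hadj p (by omega)) with h | h | h
  · exact hne _ _ (by omega) h
  · exact hne _ _ (by omega) h
  · exact hne _ _ (by omega) h

end IsSimpleSystem

theorem neg_one_le_cartanMatrix_A (n : ℕ) (i j : Fin n) : -1 ≤ CartanMatrix.A n i j := by
  simp only [CartanMatrix.A, Matrix.of_apply]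
  split_ifs <;> norm_num

theorem neg_one_le_cartanMatrix_D (n : ℕ) (i j : Fin n) : -1 ≤ CartanMatrix.D n i j := by
  simp only [CartanMatrix.D, Matrix.of_apply]
  split_ifs <;> norm_num

end Converse

/-! ### Independence of the base and the classification -/

namespace Subsystem

variable {N : Type*} [AddCommGroup N] [Module.Free ℤ N] [Module.Finite ℤ N]
    {ι : Type*} [Fintype ι] {v : ι → N}
    {hv : finrank ℤ (Submodule.span ℤ (Set.range v)) = finrank ℤ N} {Φ : Subsystem v}

/-- If all roots are of type 2, then the existence of two conjugate simple roots does not depend on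
the choice of the base. -/
theorem exists_sameSupport_of_base (hirr : (Φ.rootPairing hv).IsIrreducible)
    (b b' : (Φ.rootPairing hv).Base) (hl : ∀ k, IsLong (simpleVec b' k))
    (h : ∃ k l, k ≠ l ∧ SameSupport (simpleVec b k) (simpleVec b l)) :
    ∃ k l, k ≠ l ∧ SameSupport (simpleVec b' k) (simpleVec b' l) := by
  by_contra! hns
  -- Orthogonality to `ε` passes from `b'` to all roots, so a conjugate pair in `b` would be equal
  -- or opposite.
  obtain ⟨ε, hε, hεb⟩ := (isSimpleSystem_simpleVec b').exists_orthogonal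
    (connected_dotGraph_simpleVec b' hirr) hl hns
  have hΦ := dotProduct_evalVec_eq_zero b' hεb
  obtain ⟨k, l, hkl, hs⟩ := h
  have hx := isSimpleSystem_simpleVec b
  exact (hs.eq_or_eq_neg_of_orthogonal hε (hΦ k.1) (hΦ l.1)).elim (hx.ne_of_ne hkl)
    (hx.ne_neg_of_ne hkl)

theorem isLong_of_base {b b' : (Φ.rootPairing hv).Base} (h : ∀ k, IsLong (simpleVec b k))
    (k : b'.support) : IsLong (simpleVec b' k) :=
  isLong_evalVec.mpr (isType2_of_forall_support b ((forall_isType2_iff b).mpr h) k.1)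

variable (hirr : (Φ.rootPairing hv).IsIrreducible) (hrank : 2 ≤ Φ.rank)
  (b : (Φ.rootPairing hv).Base)
include hirr hrank

theorem isOfTypeB_iff :
    IsOfTypeB (Φ.rootPairing hv) ↔ ∃ α ∈ b.support, IsType1 v α.1 := by
  constructor
  · rintro ⟨n, -, h⟩
    obtain ⟨-, b', hb'⟩ := exists_numbering_of_hasCartanMatrix h
    obtain ⟨k, hk⟩ := (isSimpleSystem_simpleVec b').exists_isShort_of_hasCartanNumbering_B
      (by rwa [card_support b']) hb'
    by_contra! hno
    have hlong : ∀ l, IsLong (simpleVec b l) := (forall_isType2_iff b).mp fun α hα ↦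
      (Φ.subset_rootSet α.2).resolve_left (hno α hα)
    exact hk.not_isLong (isLong_of_base hlong k)
  · rintro ⟨α, hα, h⟩
    exact ⟨Φ.rank, hrank, hasCartanMatrix_of_numbering b
      ((isSimpleSystem_simpleVec b).hasCartanNumbering_B (connected_dotGraph_simpleVec b hirr)
        (s := ⟨α, hα⟩) (isShort_evalVec.mpr h))⟩

theorem isOfTypeD_iff :
    IsOfTypeD (Φ.rootPairing hv) ↔
      4 ≤ Φ.rank ∧ (∀ α ∈ b.support, IsType2 v α.1) ∧
        ∃ α ∈ b.support, ∃ β ∈ b.support, IsConjugate v α.1 β.1 := by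
  rw [exists_isConjugate_iff, forall_isType2_iff]
  constructor
  · rintro ⟨n, hn, h⟩
    obtain ⟨rfl, b', hb'⟩ := exists_numbering_of_hasCartanMatrix h
    have hx := isSimpleSystem_simpleVec b'
    have hl := hx.isLong_of_hasCartanNumbering (connected_dotGraph_simpleVec b' hirr)
      (by rwa [card_support b']) neg_one_le_cartanMatrix_D hb'
    refine ⟨hn, isLong_of_base hl, exists_sameSupport_of_base hirr b' b (isLong_of_base hl) ?_⟩
    by_contra! hns
    exact hx.not_hasDegreeLeTwo_of_hasCartanNumbering_D (by rwa [card_support b']) hb'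
      (hx.hasDegreeLeTwo hns)
  · rintro ⟨h4, hl, p, q, hpq, hs⟩
    exact ⟨Φ.rank, h4, hasCartanMatrix_of_numbering b
      ((isSimpleSystem_simpleVec b).hasCartanNumbering_D (connected_dotGraph_simpleVec b hirr)
        hl hpq hs)⟩

theorem isOfTypeA_of_hasDegreeLeTwo (hl : ∀ k, IsLong (simpleVec b k))
    (h2 : HasDegreeLeTwo (dotGraph (simpleVec b))) : IsOfTypeA (Φ.rootPairing hv) :=
  ⟨Φ.rank, by omega, hasCartanMatrix_of_numbering b
    ((isSimpleSystem_simpleVec b).hasCartanNumbering_A (connected_dotGraph_simpleVec b hirr)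
      hl h2)⟩

theorem isOfTypeA_iff :
    IsOfTypeA (Φ.rootPairing hv) ↔
      (∀ α ∈ b.support, IsType2 v α.1) ∧
        (Φ.rank = 3 ∨ ¬ ∃ α ∈ b.support, ∃ β ∈ b.support, IsConjugate v α.1 β.1) := by
  rw [exists_isConjugate_iff, forall_isType2_iff]
  constructor
  · rintro ⟨n, hn, h⟩
    obtain ⟨rfl, b', hb'⟩ := exists_numbering_of_hasCartanMatrix h
    have hx := isSimpleSystem_simpleVec b'
    have hc := connected_dotGraph_simpleVec b' hirr
    have hl := hx.isLong_of_hasCartanNumbering hc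
      (by rwa [card_support b']) neg_one_le_cartanMatrix_A hb'
    refine ⟨isLong_of_base hl, ?_⟩
    by_contra! hne
    obtain ⟨hne3, hconj⟩ := hne
    obtain ⟨p, q, hpq, hs⟩ := exists_sameSupport_of_base hirr b b' hl hconj
    have h3 := hx.three_le_card hc hpq hs
    -- A conjugate pair forces rank at least 3, hence at least 4 here; the same base would then
    -- carry both a D fork and an A path.
    refine hx.not_hasDegreeLeTwo_of_hasCartanNumbering_D ?_
      (hx.hasCartanNumbering_D hc hl hpq hs) (hx.hasDegreeLeTwo_of_hasCartanNumbering_A hb')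
    rw [card_support b'] at h3 ⊢
    omega
  · rintro ⟨hl, h⟩
    refine isOfTypeA_of_hasDegreeLeTwo hirr hrank b hl ?_
    rcases h with h | h
    · exact hasDegreeLeTwo_of_card_le_three (by rw [card_support b, h])
    · push Not at h
      exact (isSimpleSystem_simpleVec b).hasDegreeLeTwo h

theorem isOfTypeA_or_B_or_D :
    IsOfTypeA (Φ.rootPairing hv) ∨ IsOfTypeB (Φ.rootPairing hv) ∨
      IsOfTypeD (Φ.rootPairing hv) := by
  have := Φ.finite_carrier hv
  have := Φ.isReduced_rootPairing hv
  have := Φ.isRootSystem_rootPairing hv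
  obtain ⟨b⟩ := (Φ.rootPairing hv).nonempty_base
  by_cases hB : ∃ α ∈ b.support, IsType1 v α.1
  · exact Or.inr (Or.inl ((isOfTypeB_iff hirr hrank b).mpr hB))
  push Not at hB
  have hl : ∀ α ∈ b.support, IsType2 v α.1 := fun α hα ↦
    (Φ.subset_rootSet α.2).resolve_left (hB α hα)
  by_cases hconj : ∃ α ∈ b.support, ∃ β ∈ b.support, IsConjugate v α.1 β.1
  · by_cases h4 : 4 ≤ Φ.rank
    · exact Or.inr (Or.inr ((isOfTypeD_iff hirr hrank b).mpr ⟨h4, hl, hconj⟩))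
    -- In rank at most 3 a conjugate pair still gives a path, so the type is A.
    · exact Or.inl (isOfTypeA_of_hasDegreeLeTwo hirr hrank b ((forall_isType2_iff b).mp hl)
        (hasDegreeLeTwo_of_card_le_three (by rw [card_support b]; omega)))
  · exact Or.inl ((isOfTypeA_iff hirr hrank b).mpr ⟨hl, Or.inr hconj⟩)

end Subsystem

end LatticeRoots

theorem theorem2p1 {N : Type*} [AddCommGroup N] [Module.Free ℤ N] [Module.Finite ℤ N]
    {ι : Type*} [Fintype ι] (v : ι → N) (hv0 : ∀ i, v i ≠ 0)
    (hv : Module.finrank ℤ (Submodule.span ℤ (Set.range v)) = Module.finrank ℤ N)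
    (Φ : Subsystem v) (hirr : (Φ.rootPairing hv).IsIrreducible) (hrank : 2 ≤ Φ.rank) :
    (IsOfTypeA (Φ.rootPairing hv) ∨ IsOfTypeB (Φ.rootPairing hv) ∨
      IsOfTypeD (Φ.rootPairing hv)) ∧
    ∀ b : (Φ.rootPairing hv).Base,
      (IsOfTypeB (Φ.rootPairing hv) ↔ ∃ α ∈ b.support, IsType1 v α.1) ∧
      (IsOfTypeD (Φ.rootPairing hv) ↔
        4 ≤ Φ.rank ∧ (∀ α ∈ b.support, IsType2 v α.1) ∧
          ∃ α ∈ b.support, ∃ β ∈ b.support, IsConjugate v α.1 β.1) ∧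
      (IsOfTypeA (Φ.rootPairing hv) ↔
        (∀ α ∈ b.support, IsType2 v α.1) ∧
          (Φ.rank = 3 ∨ ¬ ∃ α ∈ b.support, ∃ β ∈ b.support, IsConjugate v α.1 β.1)) :=
  ⟨Subsystem.isOfTypeA_or_B_or_D hirr hrank, fun b ↦
    ⟨Subsystem.isOfTypeB_iff hirr hrank b, Subsystem.isOfTypeD_iff hirr hrank b,
      Subsystem.isOfTypeA_iff hirr hrank b⟩⟩
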